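/- **Theorem 2.1.** Let $\mathbb{T}=\mathbb{R}/(2\pi\mathbb{Z})$, let $a,b,b_1\in\mathbb{R}$ with $a\neq 0$ and $b\neq 0$, let $T>\frac{2\pi |b|}{|a|}$, and let $q,p,r\in L^\infty(0,T;L^\infty(\mathbb{T}))$ be real-valued functions of $(x,t)\in\mathbb{T}\times(0,T)$. Let $\omega\subset\mathbb{T}$ be a nonempty open set. Let $u\in L^2(0,T;H^4(\mathbb{T}))\cup L^\infty(0,T;H^3(\mathbb{T}))$ be a real-valued function satisfying $$u_t-b_1u_{txx}+b\,u_{txxxx}+a\,u_{xxxxx}+q\,u_x+p\,u_{xxx}+r\,u_{xx}=0$$ in the sense of distributions on $\mathbb{T}\times(0,T)$, that is, for all $\varphi\in C_c^\infty(\mathbb{T}\times(0,T))$, $$\int_0^T\!\!\int_{\mathbb{T}}\Big[u\,\big(-\varphi_t+b_1\varphi_{txx}-b\,\varphi_{txxxx}-a\,\varphi_{xxxxx}\big)+\big(q\,u_x+p\,u_{xxx}+r\,u_{xx}\big)\varphi\Big]\,dx\,dt=0 .$$ If $u(x,t)=0$ for a.e. $(x,t)\in\omega\times(0,T)$, then $u=0$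 a.e. in $\mathbb{T}\times(0,T)$. -/

import Mathlib

open MeasureTheory Set
open scoped ENNReal ContDiff Real

noncomputable section

/-- The torus `ℝ / 2πℤ`, with Lebesgue measure of total mass `2π`. -/
abbrev Torus : Type := AddCircle (2 * π)

instance fact_zero_lt_two_pi : Fact (0 < 2 * π) := ⟨Real.two_pi_pos⟩

/-- The classical derivative of a function on the torus. -/
def torusDeriv (f : Torus → ℝ) : Torus → ℝ :=
  fun x => deriv (fun h : ℝ => f (x + (h : Torus))) 0

/-- Smooth functions on the torus: those whose `2π`-periodic lift to `ℝ` is smooth. -/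
def TorusSmooth (φ : Torus → ℝ) : Prop :=
  ContDiff ℝ ∞ (fun y : ℝ => φ (y : Torus))

/-- `g ∈ L²(𝕋)` is the `j`-th order weak derivative of `f ∈ L²(𝕋)`. -/
def IsWeakDeriv (j : ℕ) (f g : Torus → ℝ) : Prop :=
  MemLp f 2 volume ∧ MemLp g 2 volume ∧
    ∀ φ : Torus → ℝ, TorusSmooth φ →
      ∫ x, f x * torusDeriv^[j] φ x = (-1) ^ j * ∫ x, g x * φ x

/-- Lebesgue measure on the time interval `(0,T)`. -/
def timeMeasure (T : ℝ) : Measure ℝ := volume.restrict (Ioo 0 T)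

/-- Lebesgue measure on `𝕋 × (0,T)`. -/
def spaceTimeMeasure (T : ℝ) : Measure (Torus × ℝ) :=
  (volume : Measure Torus).prod (timeMeasure T)

/-- `v = ∂ₓʲ u` on `𝕋 × (0,T)`: both are measurable in `(x,t)`, and for almost every `t ∈ (0,T)`
the slice `v(·,t) ∈ L²(𝕋)` is the `j`-th order weak derivative of `u(·,t) ∈ L²(𝕋)`. -/
def IsWeakSpaceDeriv (T : ℝ) (j : ℕ) (u v : Torus → ℝ → ℝ) : Prop :=
  AEStronglyMeasurable (Function.uncurry u) (spaceTimeMeasure T) ∧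
    AEStronglyMeasurable (Function.uncurry v) (spaceTimeMeasure T) ∧
    ∀ᵐ t ∂(timeMeasure T), IsWeakDeriv j (fun x => u x t) (fun x => v x t)

/-- `u ∈ L^p(0,T; H^k(𝕋))`: for each `j ≤ k` the slices `u(·,t)` have a weak derivative `∂ₓʲ u(·,t)`
in `L²(𝕋)` for a.e. `t`, measurably in `(x,t)`, and `t ↦ ‖∂ₓʲ u(·,t)‖_{L²(𝕋)}` is in `L^p(0,T)`. -/
def MemLpSobolev (p : ℝ≥0∞) (k : ℕ) (T : ℝ) (u : Torus → ℝ → ℝ) : Prop :=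
  ∀ j ≤ k, ∃ v : Torus → ℝ → ℝ, IsWeakSpaceDeriv T j u v ∧
    MemLp (fun t => (eLpNorm (fun x => v x t) 2 volume).toReal) p (timeMeasure T)

/-- `g ∈ L^∞(0,T; L^∞(𝕋))`, as a measurable, essentially bounded function on `𝕋 × (0,T)`. -/
def MemLinftyLinfty (T : ℝ) (g : Torus → ℝ → ℝ) : Prop :=
  MemLp (Function.uncurry g) ∞ (spaceTimeMeasure T)

/-- Test functions `φ ∈ C_c^∞(𝕋 × (0,T))`. -/
def IsTestFunction (T : ℝ) (φ : Torus → ℝ → ℝ) : Prop :=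
  ContDiff ℝ ∞ (fun y : ℝ × ℝ => φ (y.1 : Torus) y.2) ∧
    ∃ K : Set ℝ, IsCompact K ∧ K ⊆ Ioo 0 T ∧ ∀ x t, t ∉ K → φ x t = 0

/-- The derivative `∂ₓʲ φ`. -/
def dX (j : ℕ) (φ : Torus → ℝ → ℝ) (x : Torus) (t : ℝ) : ℝ :=
  torusDeriv^[j] (fun y => φ y t) x

/-- The derivative `∂ₜ ∂ₓʲ φ`. -/
def dTX (j : ℕ) (φ : Torus → ℝ → ℝ) (x : Torus) (t : ℝ) : ℝ :=
  deriv (fun s => dX j φ x s) t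

/-- `u` satisfies
`u_t - b₁ u_txx + b u_txxxx + a u_xxxxx + q u_x + p u_xxx + r u_xx = 0`
in the sense of distributions on `𝕋 × (0,T)`. The functions `u₁, u₂, u₃` are `u_x, u_xx, u_xxx`. -/
def IsWeakSolution (a b b₁ T : ℝ) (q p r u : Torus → ℝ → ℝ) : Prop :=
  ∃ u₁ u₂ u₃ : Torus → ℝ → ℝ,
    IsWeakSpaceDeriv T 1 u u₁ ∧ IsWeakSpaceDeriv T 2 u u₂ ∧ IsWeakSpaceDeriv T 3 u u₃ ∧
    ∀ φ : Torus → ℝ → ℝ, IsTestFunction T φ →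
      ∫ z, (u z.1 z.2 * (-(dTX 0 φ z.1 z.2) + b₁ * dTX 2 φ z.1 z.2 - b * dTX 4 φ z.1 z.2
              - a * dX 5 φ z.1 z.2)
          + (q z.1 z.2 * u₁ z.1 z.2 + p z.1 z.2 * u₃ z.1 z.2 + r z.1 z.2 * u₂ z.1 z.2)
              * φ z.1 z.2) ∂(spaceTimeMeasure T) = 0

end

/-! The principal part of the equation is `∂ₓ⁴ (b ∂ₜ + a ∂ₓ)`. Its characteristic curves are the
lines `t = const` and the lines of direction `(1, b/a)`; both are transversal to `x = const`, so `x`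
can serve as the evolution variable, and vanishing near a point of the circle provides zero Cauchy
data there. Put `k = b/a` and `D = ∂ₓ + k ∂ₜ`. Multiplying the equation by `k` and replacing `k ∂ₜ`
by `D - ∂ₓ` gives `D (∂ₓ (b u_xxx - b₁ u_x) + u) = -F`, where `F = k (q u_x + p u_xxx + r u_xx) -
u_x + b₁ u_xxx`. No time derivative is left in `F`, and `|F| ≤ C (|u_x| + |u_xx| + |u_xxx|)`.

Cut the circle at a point of the open set and extend the functions by zero to `x ≤ 0`. Write `P₀`,
`P_k` for integration backwards along `(1, 0)` and `(1, k)` (`pastIntegral`). Then `b u_xxx = b₁ u_x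
- P₀ u - P₀ P_k F`, while `u = P₀ u_x`, `u_x = P₀ u_xx` and `u_xx = P₀ u_xxx` (`ae_transport_eq`,
`ae_eq_pastIntegral`). These identities hold where the backward ray along `(1, k)` reaches `x = 0`
at a time inside `(0, T)`, so no data at `t = 0` or `t = T` are needed. In an `L¹` norm with weight
`exp (-l x)` each backward integration gains a factor `1/l` (`weightedNorm_pastIntegral_le`); for
large `l` this Volterra system forces `u_xxx = 0`, hence `u = 0`, on that domain
(`ae_eq_zero_on_domainOfDependence`).

Going round the circle in the two orientations gives two such domains (`ae_eq_zero_of_chart`). They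
cover everything, because the feet of the two characteristic rays through a point differ in time by
`2π |k| < T`. -/

/-! ### Directional derivatives in the plane -/

/-- The derivative of a function on the plane in the direction `d`. -/
noncomputable def dirDeriv (d : ℝ × ℝ) (φ : ℝ × ℝ → ℝ) (p : ℝ × ℝ) : ℝ := fderiv ℝ φ p d

lemma ContDiff.dirDeriv {φ : ℝ × ℝ → ℝ} (hφ : ContDiff ℝ ∞ φ) (d : ℝ × ℝ) :
    ContDiff ℝ ∞ (dirDeriv d φ) :=
  (hφ.fderiv_right (m := ∞) (by simp)).clm_apply contDiff_const

lemma ContDiff.dirDeriv_iterate {φ : ℝ × ℝ → ℝ} (hφ : ContDiff ℝ ∞ φ) (d : ℝ × ℝ) (j : ℕ) :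
    ContDiff ℝ ∞ ((_root_.dirDeriv d)^[j] φ) := by
  induction j with
  | zero => exact hφ
  | succ j ih => rw [Function.iterate_succ_apply']; exact ih.dirDeriv d

lemma dirDeriv_comm {φ : ℝ × ℝ → ℝ} (hφ : ContDiff ℝ ∞ φ) (d e : ℝ × ℝ) :
    dirDeriv d (dirDeriv e φ) = dirDeriv e (dirDeriv d φ) := by
  have hd : Differentiable ℝ (fderiv ℝ φ) :=
    (hφ.fderiv_right (m := ∞) (by simp)).differentiable (by simp)
  have key : ∀ d e p, dirDeriv d (dirDeriv e φ) p = fderiv ℝ (fderiv ℝ φ) p d e := by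
    intro d e p
    unfold dirDeriv
    rw [fderiv_clm_apply (hd p) (differentiableAt_const e)]
    simp
  funext p
  rw [key, key]
  exact (contDiff_infty.1 hφ 2).contDiffAt.isSymmSndFDerivAt (by simp) d e

lemma dirDeriv_eq_add (k : ℝ) (φ : ℝ × ℝ → ℝ) :
    dirDeriv (1, k) φ = fun p => dirDeriv (1, 0) φ p + k * dirDeriv (0, 1) φ p := by
  funext p
  have : ((1, k) : ℝ × ℝ) = (1, 0) + k • (0, 1) := by simp
  unfold dirDeriv
  rw [this, map_add, map_smul, smul_eq_mul]

lemma dirDeriv_congr {d : ℝ × ℝ} {φ ψ : ℝ × ℝ → ℝ} {p : ℝ × ℝ} (h : φ =ᶠ[nhds p] ψ) :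
    dirDeriv d φ =ᶠ[nhds p] dirDeriv d ψ :=
  h.fderiv.mono fun q hq => by unfold dirDeriv; rw [hq]

lemma dirDeriv_eq_zero_of_eventuallyEq {d : ℝ × ℝ} {φ : ℝ × ℝ → ℝ} {p : ℝ × ℝ}
    (h : φ =ᶠ[nhds p] fun _ => 0) : dirDeriv d φ p = 0 := by
  unfold dirDeriv; rw [h.fderiv_eq]; simp

/-! ### Integrals along segments and their smoothness -/

section Smooth

variable {E F : Type} [NormedAddCommGroup E] [NormedSpace ℝ E] [ProperSpace E]
  [NormedAddCommGroup F] [NormedSpace ℝ F]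

lemma hasFDerivAt_integral_translate {f : E → F} (hf : ContDiff ℝ 1 f) (d : E) (R : ℝ) (x : E) :
    HasFDerivAt (fun x => ∫ s in (0 : ℝ)..R, f (x + s • d))
      (∫ s in (0 : ℝ)..R, fderiv ℝ f (x + s • d)) x := by
  have hf' : Continuous (fderiv ℝ f) := hf.continuous_fderiv (by simp)
  have hc : Continuous fun z : E × ℝ => fderiv ℝ f (z.1 + z.2 • d) := by fun_prop
  obtain ⟨C, hC⟩ := ((isCompact_closedBall x 1).prod (isCompact_uIcc (a := (0 : ℝ)) (b := R)))
    |>.exists_bound_of_continuousOn hc.continuousOn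
  have hfc := hf.continuous
  refine intervalIntegral.hasFDerivAt_integral_of_dominated_of_fderiv_le
    (F := fun x s => f (x + s • d)) (F' := fun x s => fderiv ℝ f (x + s • d)) (bound := fun _ => C)
    (Metric.closedBall_mem_nhds x one_pos) ?_ ?_ ?_ ?_ ?_ ?_
  · exact Filter.Eventually.of_forall fun y =>
      (by fun_prop : Continuous fun s : ℝ => f (y + s • d)).aestronglyMeasurable
  · exact (by fun_prop : Continuous fun s : ℝ => f (x + s • d)).intervalIntegrable _ _
  · exact (by fun_prop : Continuous fun s : ℝ => fderiv ℝ f (x + s • d)).aestronglyMeasurable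
  · exact Filter.Eventually.of_forall fun s hs y hy =>
      hC (y, s) ⟨hy, uIoc_subset_uIcc hs⟩
  · exact intervalIntegrable_const
  · refine Filter.Eventually.of_forall fun s _ y _ => ?_
    have := ((hf.differentiable (by simp)) (y + s • d)).hasFDerivAt
    simpa [Function.comp_def] using this.comp y ((hasFDerivAt_id y).add_const (s • d))

end Smooth

/-- Differentiation passes under the integral. The induction quantifies over the target space
because the derivative is the same kind of integral with values in `E →L[ℝ] F`. -/
lemma contDiff_nat_integral_translate {E : Type} [NormedAddCommGroup E] [NormedSpace ℝ E]
    [ProperSpace E] (d : E) (R : ℝ) (n : ℕ) :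
    ∀ {F : Type} [NormedAddCommGroup F] [NormedSpace ℝ F] {f : E → F}, ContDiff ℝ n f →
    ContDiff ℝ n (fun x => ∫ s in (0 : ℝ)..R, f (x + s • d)) := by
  induction n with
  | zero =>
    intro F _ _ f hf
    have hfc := hf.continuous
    exact contDiff_zero.2 (intervalIntegral.continuous_parametric_intervalIntegral_of_continuous'
      (f := fun x s => f (x + s • d)) (by unfold Function.uncurry; fun_prop) 0 R)
  | succ n ih =>
    intro F _ _ f hf
    refine contDiff_succ_iff_hasFDerivAt.2
      ⟨fun x => ∫ s in (0 : ℝ)..R, fderiv ℝ f (x + s • d), ?_, fun x => ?_⟩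
    · exact ih (hf.fderiv_right (by simp))
    · exact hasFDerivAt_integral_translate (hf.of_le (by simp)) d R x

/-- The integral of `ψ` along the segment `p + s • (1, m)`, `0 ≤ s ≤ 2π`. -/
noncomputable def rayIntegral (m : ℝ) (ψ : ℝ × ℝ → ℝ) (p : ℝ × ℝ) : ℝ :=
  ∫ s in (0 : ℝ)..(2 * π), ψ (p + s • ((1, m) : ℝ × ℝ))

lemma ContDiff.rayIntegral {ψ : ℝ × ℝ → ℝ} (hψ : ContDiff ℝ ∞ ψ) (m : ℝ) :
    ContDiff ℝ ∞ (rayIntegral m ψ) :=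
  contDiff_infty.2 fun n => contDiff_nat_integral_translate _ _ n (contDiff_infty.1 hψ n)

/-- Fundamental theorem of calculus along the segment. For `ψ` supported in `x < 2π`, the far
endpoint contributes nothing over `x > 0`, so `-rayIntegral m` inverts the derivative there. -/
lemma dirDeriv_rayIntegral {ψ : ℝ × ℝ → ℝ} (hψ : ContDiff ℝ ∞ ψ) (m : ℝ) (p : ℝ × ℝ) :
    dirDeriv (1, m) (rayIntegral m ψ) p = ψ (p + (2 * π) • ((1, m) : ℝ × ℝ)) - ψ p := by
  have h1 := hasFDerivAt_integral_translate (hψ.of_le (by simp)) ((1, m) : ℝ × ℝ) (2 * π) p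
  have hc : Continuous (fderiv ℝ ψ) := hψ.continuous_fderiv (by simp)
  have hc' : Continuous fun s : ℝ => fderiv ℝ ψ (p + s • ((1, m) : ℝ × ℝ)) := by fun_prop
  have h2 : dirDeriv (1, m) (rayIntegral m ψ) p
      = ∫ s in (0 : ℝ)..(2 * π), fderiv ℝ ψ (p + s • ((1, m) : ℝ × ℝ)) (1, m) := by
    unfold dirDeriv
    rw [show fderiv ℝ (rayIntegral m ψ) p = _ from h1.fderiv,
      ContinuousLinearMap.intervalIntegral_apply (hc'.intervalIntegrable _ _)]
  rw [h2, intervalIntegral.integral_eq_sub_of_hasDerivAt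
    (f := fun s : ℝ => ψ (p + s • ((1, m) : ℝ × ℝ)))]
  · simp
  · intro s _
    have h3 := ((hψ.differentiable (by simp)) (p + s • ((1, m) : ℝ × ℝ))).hasFDerivAt
    have h4 : HasDerivAt (fun s : ℝ => p + s • ((1, m) : ℝ × ℝ)) (1, m) s := by
      simpa using ((hasDerivAt_id s).smul_const ((1, m) : ℝ × ℝ)).const_add p
    exact h3.comp_hasDerivAt s h4
  · exact (hc'.clm_apply continuous_const).intervalIntegrable _ _

/-! ### Backward integration and duality -/

/-- The integral of `g` along the segment `p - s • (1, m)`, `0 ≤ s ≤ 2π`. -/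
noncomputable def pastIntegral (m : ℝ) (g : ℝ × ℝ → ℝ) (p : ℝ × ℝ) : ℝ :=
  ∫ s in Ioc (0 : ℝ) (2 * π), g (p - s • ((1, m) : ℝ × ℝ))

/-- For fixed first coordinate this is a translation. It carries joint integrability and joint
measurability over to functions of `p - s • d`. -/
lemma measurePreserving_shear (d : ℝ × ℝ) (μ : Measure ℝ) [SFinite μ] :
    MeasurePreserving (fun z : ℝ × (ℝ × ℝ) => (z.1, z.2 - z.1 • d))
      (μ.prod volume) (μ.prod volume) := by
  refine (MeasurePreserving.id μ).skew_product (g := fun (s : ℝ) (p : ℝ × ℝ) => p - s • d) ?_ ?_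
  · unfold Function.uncurry
    fun_prop
  · exact Filter.Eventually.of_forall fun s => (measurePreserving_sub_right volume (s • d)).map_eq

lemma integrable_mul_translate {g ψ : ℝ × ℝ → ℝ} (hg : Integrable g) (hψ : Continuous ψ) {C : ℝ}
    (hC : ∀ p, ‖ψ p‖ ≤ C) (d : ℝ × ℝ) :
    Integrable (fun z : ℝ × (ℝ × ℝ) => g z.2 * ψ (z.2 + z.1 • d))
      ((volume.restrict (Ioc (0 : ℝ) (2 * π))).prod volume) := by
  have h1 : Integrable (fun z : ℝ × (ℝ × ℝ) => g z.2)
      ((volume.restrict (Ioc (0 : ℝ) (2 * π))).prod volume) := by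
    simpa using (integrable_const (μ := volume.restrict (Ioc (0 : ℝ) (2 * π))) (1 : ℝ)).mul_prod hg
  exact h1.mul_bdd (by fun_prop : Continuous fun z : ℝ × (ℝ × ℝ) =>
    ψ (z.2 + z.1 • d)).aestronglyMeasurable (Filter.Eventually.of_forall fun z => hC _)

lemma integrable_translate_mul {g ψ : ℝ × ℝ → ℝ} (hg : Integrable g) (hψ : Continuous ψ) {C : ℝ}
    (hC : ∀ p, ‖ψ p‖ ≤ C) (d : ℝ × ℝ) :
    Integrable (fun z : ℝ × (ℝ × ℝ) => g (z.2 - z.1 • d) * ψ z.2)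
      ((volume.restrict (Ioc (0 : ℝ) (2 * π))).prod volume) := by
  have := (measurePreserving_shear d (volume.restrict (Ioc (0 : ℝ) (2 * π)))).integrable_comp_of_integrable
    (integrable_mul_translate hg hψ hC d)
  simpa [Function.comp_def] using this

lemma Integrable.pastIntegral {g : ℝ × ℝ → ℝ} (hg : Integrable g) (m : ℝ) :
    Integrable (pastIntegral m g) := by
  have := (integrable_translate_mul hg (ψ := fun _ => 1) continuous_const (C := 1) (by simp)
    (1, m)).integral_prod_right
  simp only [mul_one] at this
  exact this

/-- Forward integration along a ray is adjoint to backward integration. -/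
lemma integral_mul_rayIntegral {g ψ : ℝ × ℝ → ℝ} (hg : Integrable g) (hψ : Continuous ψ) {C : ℝ}
    (hC : ∀ p, ‖ψ p‖ ≤ C) (m : ℝ) :
    ∫ p, g p * rayIntegral m ψ p = ∫ p, pastIntegral m g p * ψ p := by
  have e1 : ∀ p, g p * rayIntegral m ψ p
      = ∫ s in Ioc (0 : ℝ) (2 * π), g p * ψ (p + s • ((1, m) : ℝ × ℝ)) := by
    intro p
    rw [integral_const_mul, rayIntegral, intervalIntegral.integral_of_le Real.two_pi_pos.le]
  have e2 : ∀ p, pastIntegral m g p * ψ p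
      = ∫ s in Ioc (0 : ℝ) (2 * π), g (p - s • ((1, m) : ℝ × ℝ)) * ψ p := by
    intro p
    rw [integral_mul_const, pastIntegral]
  simp_rw [e1, e2]
  rw [← integral_integral_swap (f := fun (s : ℝ) (p : ℝ × ℝ) => g p * ψ (p + s • ((1, m) : ℝ × ℝ)))
      (integrable_mul_translate hg hψ hC _),
    ← integral_integral_swap (f := fun (s : ℝ) (p : ℝ × ℝ) => g (p - s • ((1, m) : ℝ × ℝ)) * ψ p)
      (integrable_translate_mul hg hψ hC _)]
  refine integral_congr_ae (Filter.Eventually.of_forall fun s => ?_)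
  have := integral_sub_right_eq_self (μ := (volume : Measure (ℝ × ℝ)))
    (fun p => g p * ψ (p + s • ((1, m) : ℝ × ℝ))) (s • ((1, m) : ℝ × ℝ))
  simp only [sub_add_cancel] at this
  exact this.symm

/-! ### The domain of dependence of the side `x = 0` -/

/-- The space-time cell. -/
def cell (T : ℝ) : Set (ℝ × ℝ) := Ioo 0 (2 * π) ×ˢ Ioo 0 T

/-- The points of the cell whose backward ray in the direction `(1, k)` leaves the cell through the
side `{0} × (0, T)`. -/
def domainOfDependence (k T : ℝ) : Set (ℝ × ℝ) :=
  {p | p ∈ cell T ∧ p.2 - k * p.1 ∈ Ioo 0 T}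

lemma isOpen_cell (T : ℝ) : IsOpen (cell T) := isOpen_Ioo.prod isOpen_Ioo

lemma isOpen_domainOfDependence (k T : ℝ) : IsOpen (domainOfDependence k T) :=
  (isOpen_cell T).inter (isOpen_Ioo.preimage (by fun_prop))

/-- A step back along `(1, 0)` keeps `t` and moves the foot `t - k x` towards `t`; a step back along
`(1, k)` keeps the foot and moves `t` towards it. Either way both numbers stay between the original
two as long as `x` remains positive. -/
lemma domainOfDependence_past {k T m : ℝ} (hm : m = 0 ∨ m = k) {p : ℝ × ℝ}
    (hp : p ∈ domainOfDependence k T) {s : ℝ} (hs : 0 < s)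
    (h : 0 < (p - s • ((1, m) : ℝ × ℝ)).1) :
    p - s • ((1, m) : ℝ × ℝ) ∈ domainOfDependence k T := by
  obtain ⟨x, t⟩ := p
  simp only [domainOfDependence, cell, mem_ofPred_eq, mem_prod, mem_Ioo, Prod.fst_sub, Prod.snd_sub,
    Prod.smul_mk, smul_eq_mul, mul_one] at *
  obtain ⟨⟨⟨h1, h2⟩, h3, h4⟩, h5, h6⟩ := hp
  have e : k * (x - s) = k * x - k * s := by ring
  rcases le_total 0 k with hk | hk <;> rcases hm with rfl | rfl
  · have a1 := mul_nonneg hk hs.le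
    have a2 := mul_nonneg hk h.le
    refine ⟨⟨⟨?_, ?_⟩, ?_, ?_⟩, ?_, ?_⟩ <;> linarith
  · have a1 := mul_nonneg hk hs.le
    have a2 := mul_nonneg hk h.le
    have a3 : s * m = m * s := mul_comm _ _
    refine ⟨⟨⟨?_, ?_⟩, ?_, ?_⟩, ?_, ?_⟩ <;> linarith
  · have a1 := mul_nonpos_of_nonpos_of_nonneg hk hs.le
    have a2 := mul_nonpos_of_nonpos_of_nonneg hk h.le
    refine ⟨⟨⟨?_, ?_⟩, ?_, ?_⟩, ?_, ?_⟩ <;> linarith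
  · have a1 := mul_nonpos_of_nonpos_of_nonneg hk hs.le
    have a2 := mul_nonpos_of_nonpos_of_nonneg hk h.le
    have a3 : s * m = m * s := mul_comm _ _
    refine ⟨⟨⟨?_, ?_⟩, ?_, ?_⟩, ?_, ?_⟩ <;> linarith

/-! ### Weighted norm estimates -/

/-- The exponentially weighted `L¹` norm over the domain of dependence. -/
noncomputable def weightedNorm (l k T : ℝ) (g : ℝ × ℝ → ℝ) : ℝ≥0∞ :=
  ∫⁻ p in domainOfDependence k T, ENNReal.ofReal (Real.exp (-l * p.1)) * ‖g p‖ₑ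

lemma weightedNorm_mono {l k T : ℝ} {g h : ℝ × ℝ → ℝ}
    (H : ∀ᵐ p, p ∈ domainOfDependence k T → ‖g p‖ ≤ ‖h p‖) :
    weightedNorm l k T g ≤ weightedNorm l k T h := by
  refine lintegral_mono_ae ?_
  rw [ae_restrict_iff' (isOpen_domainOfDependence k T).measurableSet]
  filter_upwards [H] with p hp hpU
  gcongr
  exact enorm_le_iff_norm_le.2 (hp hpU)

lemma weightedNorm_add_le {l k T : ℝ} {g h : ℝ × ℝ → ℝ} (hg : AEStronglyMeasurable g) :
    weightedNorm l k T (fun p => g p + h p) ≤ weightedNorm l k T g + weightedNorm l k T h := by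
  unfold weightedNorm
  rw [← lintegral_add_left']
  · refine lintegral_mono fun p => ?_
    rw [← mul_add]
    gcongr
    exact enorm_add_le _ _
  · exact (Measurable.aemeasurable (by fun_prop)).mul hg.enorm.restrict

lemma weightedNorm_const_mul {l k T : ℝ} {g : ℝ × ℝ → ℝ} (c : ℝ) :
    weightedNorm l k T (fun p => c * g p) = ‖c‖ₑ * weightedNorm l k T g := by
  unfold weightedNorm
  rw [← lintegral_const_mul' _ _ (by simp)]
  refine lintegral_congr fun p => ?_
  rw [enorm_mul]; ring

lemma weightedNorm_lt_top {l k T : ℝ} (hl : 0 ≤ l) {g : ℝ × ℝ → ℝ} (hg : Integrable g) :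
    weightedNorm l k T g < ⊤ := by
  refine lt_of_le_of_lt ?_ (hg.restrict (s := domainOfDependence k T)).2
  refine setLIntegral_mono_ae' (isOpen_domainOfDependence k T).measurableSet ?_
  refine Filter.Eventually.of_forall fun p hp => ?_
  have : Real.exp (-l * p.1) ≤ 1 := by
    rw [Real.exp_le_one_iff]
    have := hp.1.1.1
    nlinarith
  calc _ ≤ ENNReal.ofReal 1 * ‖g p‖ₑ := by gcongr
    _ = ‖g p‖ₑ := by simp

lemma ae_eq_zero_of_weightedNorm_eq_zero {l k T : ℝ} {g : ℝ × ℝ → ℝ} (hg : AEStronglyMeasurable g)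
    (h : weightedNorm l k T g = 0) : ∀ᵐ p, p ∈ domainOfDependence k T → g p = 0 := by
  unfold weightedNorm at h
  rw [lintegral_eq_zero_iff' (f := fun p => ENNReal.ofReal (Real.exp (-l * p.1)) * ‖g p‖ₑ) ((Measurable.aemeasurable (by fun_prop)).mul hg.enorm.restrict)] at h
  rw [← ae_restrict_iff' (isOpen_domainOfDependence k T).measurableSet]
  filter_upwards [h] with p hp
  simpa [(Real.exp_pos _).not_ge] using hp

lemma lintegral_exp_neg_le {l : ℝ} (hl : 0 < l) :
    ∫⁻ s in Ioc (0 : ℝ) (2 * π), ENNReal.ofReal (Real.exp (-l * s)) ≤ ENNReal.ofReal (1 / l) := by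
  have h1 := integral_exp_mul_Ioi (a := -l) (by linarith) 0
  calc _ ≤ ∫⁻ s in Ioi (0 : ℝ), ENNReal.ofReal (Real.exp (-l * s)) :=
        lintegral_mono_set Ioc_subset_Ioi_self
    _ = ENNReal.ofReal (∫ s in Ioi (0 : ℝ), Real.exp (-l * s)) :=
        (ofReal_integral_eq_lintegral_ofReal (integrableOn_exp_mul_Ioi (by linarith) 0)
          (Filter.Eventually.of_forall fun s => (Real.exp_pos _).le)).symm
    _ = _ := by rw [h1]; simp

/-- Splitting `exp (-l x) = exp (-l s) * exp (-l (x - s))` bounds the left side by an average of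
translates of the weighted `|g|`, with total mass `∫ exp (-l s) ds ≤ 1/l`. Backward rays stay in the
domain until `x ≤ 0`, where `g` vanishes, so only values of `g` inside the domain enter. -/
lemma weightedNorm_pastIntegral_le {l k T m : ℝ} (hl : 0 < l) (hm : m = 0 ∨ m = k)
    {g : ℝ × ℝ → ℝ} (hg : AEStronglyMeasurable g) (hg0 : ∀ p : ℝ × ℝ, p.1 ≤ 0 → g p = 0) :
    weightedNorm l k T (pastIntegral m g) ≤ ENNReal.ofReal (1 / l) * weightedNorm l k T g := by
  have hU := (isOpen_domainOfDependence k T).measurableSet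
  set U := domainOfDependence k T
  let H : ℝ × ℝ → ℝ≥0∞ := U.indicator fun p => ENNReal.ofReal (Real.exp (-l * p.1)) * ‖g p‖ₑ
  have hH : AEMeasurable H :=
    AEMeasurable.indicator ((Measurable.aemeasurable (by fun_prop)).mul hg.enorm) hU
  let d : ℝ × ℝ := (1, m)
  let μ : Measure ℝ := volume.restrict (Ioc (0 : ℝ) (2 * π))
  have hpt : ∀ p ∈ U, ENNReal.ofReal (Real.exp (-l * p.1)) * ‖pastIntegral m g p‖ₑ
      ≤ ∫⁻ s, ENNReal.ofReal (Real.exp (-l * s)) * H (p - s • d) ∂μ := by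
    intro p hp
    calc _ ≤ ENNReal.ofReal (Real.exp (-l * p.1)) * ∫⁻ s, ‖g (p - s • d)‖ₑ ∂μ := by
          gcongr
          exact enorm_integral_le_lintegral_enorm _
      _ = ∫⁻ s, ENNReal.ofReal (Real.exp (-l * p.1)) * ‖g (p - s • d)‖ₑ ∂μ :=
          (lintegral_const_mul' _ _ (by simp)).symm
      _ ≤ _ := by
          refine setLIntegral_mono_ae' measurableSet_Ioc (Filter.Eventually.of_forall fun s hs => ?_)
          rcases le_or_gt (p - s • d).1 0 with h | h
          · rw [hg0 _ h]; simp
          · have hq : p - s • d ∈ U := domainOfDependence_past hm hp hs.1 h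
            simp only [H, indicator_of_mem hq]
            rw [← mul_assoc, ← ENNReal.ofReal_mul (Real.exp_pos _).le, ← Real.exp_add]
            simp only [d, Prod.fst_sub, Prod.smul_mk, smul_eq_mul, mul_one]
            refine le_of_eq ?_
            congr 4
            ring
  calc weightedNorm l k T (pastIntegral m g)
      ≤ ∫⁻ p in U, ∫⁻ s, ENNReal.ofReal (Real.exp (-l * s)) * H (p - s • d) ∂μ :=
        setLIntegral_mono_ae' hU (Filter.Eventually.of_forall hpt)
    _ ≤ ∫⁻ p, ∫⁻ s, ENNReal.ofReal (Real.exp (-l * s)) * H (p - s • d) ∂μ :=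
        setLIntegral_le_lintegral _ _
    _ = ∫⁻ s, (∫⁻ p : ℝ × ℝ, ENNReal.ofReal (Real.exp (-l * s)) * H (p - s • d)) ∂μ := by
        refine (lintegral_lintegral_swap (f := fun (s : ℝ) (p : ℝ × ℝ) =>
          ENNReal.ofReal (Real.exp (-l * s)) * H (p - s • d)) ?_).symm
        have h2 : AEMeasurable (fun z : ℝ × (ℝ × ℝ) => H z.2) (μ.prod volume) := hH.comp_snd
        exact (Measurable.aemeasurable (by fun_prop)).mul
          (h2.comp_quasiMeasurePreserving (measurePreserving_shear d μ).quasiMeasurePreserving)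
    _ = ∫⁻ s, ENNReal.ofReal (Real.exp (-l * s)) * weightedNorm l k T g ∂μ := by
        refine lintegral_congr fun s => ?_
        rw [lintegral_const_mul' _ _ (by simp), lintegral_sub_right_eq_self H (s • d)]
        simp only [H, lintegral_indicator hU]
        rfl
    _ ≤ _ := by
        rw [lintegral_mul_const _ (by fun_prop)]
        gcongr
        exact lintegral_exp_neg_le hl

/-! ### Test functions in the plane -/

/-- Smooth functions on the plane which, over `0 < x < 2π`, are supported in a compact subinterval
of `(0, T)` in time. -/
def Admissible (T : ℝ) (φ : ℝ × ℝ → ℝ) : Prop :=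
  ContDiff ℝ ∞ φ ∧ ∃ t₀ t₁, 0 < t₀ ∧ t₁ < T ∧
    ∀ p : ℝ × ℝ, p.1 ∈ Ioo 0 (2 * π) → φ p ≠ 0 → p.2 ∈ Icc t₀ t₁

lemma Admissible.dirDeriv {T : ℝ} {φ : ℝ × ℝ → ℝ} (h : Admissible T φ) (d : ℝ × ℝ) :
    Admissible T (dirDeriv d φ) := by
  obtain ⟨hφ, t₀, t₁, h0, h1, hs⟩ := h
  refine ⟨hφ.dirDeriv d, t₀, t₁, h0, h1, fun p hp hne => ?_⟩
  by_contra hcon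
  refine hne (dirDeriv_eq_zero_of_eventuallyEq ?_)
  have hU : IsOpen (Ioo 0 (2 * π) ×ˢ (Icc t₀ t₁)ᶜ) := isOpen_Ioo.prod isClosed_Icc.isOpen_compl
  filter_upwards [hU.mem_nhds ⟨hp, hcon⟩] with q hq
  by_contra hq'
  exact hq.2 (hs q hq.1 hq')

lemma Admissible.dirDeriv_iterate {T : ℝ} {φ : ℝ × ℝ → ℝ} (h : Admissible T φ) (d : ℝ × ℝ)
    (j : ℕ) : Admissible T ((_root_.dirDeriv d)^[j] φ) := by
  induction j with
  | zero => exact h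
  | succ j ih => rw [Function.iterate_succ_apply']; exact ih.dirDeriv d

/-- On `x > 0`, the function is supported in `x < 2π` and, in time, between `t₀` and `t₁`, also
after transport to `x = 0` along the direction `(1, k)`. -/
def PastSupported (k t₀ t₁ : ℝ) (ψ : ℝ × ℝ → ℝ) : Prop :=
  ∀ p : ℝ × ℝ, 0 < p.1 → ψ p ≠ 0 →
    p.1 < 2 * π ∧ p.2 ∈ Icc t₀ t₁ ∧ p.2 - k * p.1 ∈ Icc t₀ t₁

/-- Dual to `domainOfDependence_past`: if the forward ray from `p` meets the support at `p'`, then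
the time and the foot of `p` lie between those of `p'`. This keeps solutions of the adjoint problem
away from `t = 0` and `t = T`. -/
lemma PastSupported.rayIntegral {k t₀ t₁ m : ℝ} {ψ : ℝ × ℝ → ℝ} (h : PastSupported k t₀ t₁ ψ)
    (hm : m = 0 ∨ m = k) : PastSupported k t₀ t₁ (rayIntegral m ψ) := by
  intro p hp hne
  have : ∃ s ∈ Icc (0 : ℝ) (2 * π), ψ (p + s • ((1, m) : ℝ × ℝ)) ≠ 0 := by
    by_contra! hcon
    refine hne ?_
    unfold _root_.rayIntegral
    rw [intervalIntegral.integral_congr (g := fun _ => 0)]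
    · simp
    · intro s hs
      rw [uIcc_of_le Real.two_pi_pos.le] at hs
      exact hcon s hs
  obtain ⟨s, hs, hψ⟩ := this
  obtain ⟨x, t⟩ := p
  have := h (((x, t) : ℝ × ℝ) + s • ((1, m) : ℝ × ℝ))
  simp only [Prod.mk_add_mk, Prod.smul_mk, smul_eq_mul, mul_one, mem_Icc] at *
  obtain ⟨h1, ⟨h2, h3⟩, h4, h5⟩ := this (by linarith [hs.1]) hψ
  have e : k * (x + s) = k * x + k * s := by ring
  rcases le_total 0 k with hk | hk <;> rcases hm with rfl | rfl
  · have a1 := mul_nonneg hk hs.1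
    have a2 := mul_nonneg hk hp.le
    refine ⟨?_, ⟨?_, ?_⟩, ?_, ?_⟩ <;> linarith [hs.1]
  · have a1 := mul_nonneg hk hs.1
    have a2 := mul_nonneg hk hp.le
    have a3 : s * m = m * s := mul_comm _ _
    refine ⟨?_, ⟨?_, ?_⟩, ?_, ?_⟩ <;> linarith [hs.1]
  · have a1 := mul_nonpos_of_nonpos_of_nonneg hk hs.1
    have a2 := mul_nonpos_of_nonpos_of_nonneg hk hp.le
    refine ⟨?_, ⟨?_, ?_⟩, ?_, ?_⟩ <;> linarith [hs.1]
  · have a1 := mul_nonpos_of_nonpos_of_nonneg hk hs.1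
    have a2 := mul_nonpos_of_nonpos_of_nonneg hk hp.le
    have a3 : s * m = m * s := mul_comm _ _
    refine ⟨?_, ⟨?_, ?_⟩, ?_, ?_⟩ <;> linarith [hs.1]

lemma PastSupported.admissible {k t₀ t₁ T : ℝ} {ψ : ℝ × ℝ → ℝ} (h : PastSupported k t₀ t₁ ψ)
    (hψ : ContDiff ℝ ∞ ψ) (h0 : 0 < t₀) (h1 : t₁ < T) : Admissible T ψ :=
  ⟨hψ, t₀, t₁, h0, h1, fun p hp hne => (h p hp.1 hne).2.1⟩

lemma PastSupported.dirDeriv_rayIntegral {k t₀ t₁ m : ℝ} {ψ : ℝ × ℝ → ℝ}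
    (h : PastSupported k t₀ t₁ ψ) (hψ : ContDiff ℝ ∞ ψ) {p : ℝ × ℝ} (hp : 0 < p.1) :
    dirDeriv (1, m) (_root_.rayIntegral m ψ) p = -ψ p := by
  rw [_root_.dirDeriv_rayIntegral hψ, sub_eq_neg_self]
  by_contra hne
  have h2 : 0 < (p + (2 * π) • ((1, m) : ℝ × ℝ)).1 := by
    simp only [Prod.fst_add, Prod.smul_mk, smul_eq_mul, mul_one]
    linarith [Real.two_pi_pos]
  have h3 := (h _ h2 hne).1
  simp only [Prod.fst_add, Prod.smul_mk, smul_eq_mul, mul_one] at h3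
  linarith

lemma IsCompact.exists_subset_Icc {a b : ℝ} {K : Set ℝ} (hK : IsCompact K) (h : K ⊆ Ioo a b) :
    ∃ s t, a < s ∧ t < b ∧ K ⊆ Icc s t := by
  rcases K.eq_empty_or_nonempty with rfl | hne
  · exact ⟨a + 1, b - 1, by linarith, by linarith, by simp⟩
  · obtain ⟨s, hs⟩ := hK.exists_isLeast hne
    obtain ⟨t, ht⟩ := hK.exists_isGreatest hne
    exact ⟨s, t, (h hs.1).1, (h ht.1).2, fun x hx => ⟨hs.2 hx, ht.2 hx⟩⟩

lemma exists_pastSupported {k T : ℝ} {ψ : ℝ × ℝ → ℝ} (hc : HasCompactSupport ψ)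
    (hU : tsupport ψ ⊆ domainOfDependence k T) :
    ∃ t₀ t₁, 0 < t₀ ∧ t₁ < T ∧ PastSupported k t₀ t₁ ψ := by
  have hK : IsCompact ((fun p : ℝ × ℝ => p.2) '' tsupport ψ
      ∪ (fun p : ℝ × ℝ => p.2 - k * p.1) '' tsupport ψ) :=
    (hc.isCompact.image (by fun_prop)).union (hc.isCompact.image (by fun_prop))
  obtain ⟨t₀, t₁, h0, h1, h⟩ := hK.exists_subset_Icc (a := 0) (b := T) (by
    rintro _ (⟨p, hp, rfl⟩ | ⟨p, hp, rfl⟩)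
    · exact (hU hp).1.2
    · exact (hU hp).2)
  refine ⟨t₀, t₁, h0, h1, fun p _ hne => ?_⟩
  have hp : p ∈ tsupport ψ := subset_tsupport _ hne
  exact ⟨(hU hp).1.1.2, h (Or.inl ⟨p, hp, rfl⟩), h (Or.inr ⟨p, hp, rfl⟩)⟩

lemma rayIntegral_bound {ψ : ℝ × ℝ → ℝ} {C : ℝ} (hC : ∀ p, ‖ψ p‖ ≤ C) (m : ℝ) (p : ℝ × ℝ) :
    ‖rayIntegral m ψ p‖ ≤ C * |2 * π - 0| :=
  intervalIntegral.norm_integral_le_of_norm_le_const fun _ _ => hC _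

lemma pastIntegral_eq_zero {m : ℝ} {g : ℝ × ℝ → ℝ} (hg : ∀ p : ℝ × ℝ, p.1 ≤ 0 → g p = 0)
    (p : ℝ × ℝ) (hp : p.1 ≤ 0) : pastIntegral m g p = 0 := by
  unfold pastIntegral
  rw [setIntegral_congr_fun (g := fun _ => 0) measurableSet_Ioc]
  · simp
  · intro s hs
    refine hg _ ?_
    simp only [Prod.fst_sub, Prod.smul_mk, smul_eq_mul, mul_one]
    linarith [hs.1]

/-! ### Solving the weak equations along backward rays -/

/-- Test with `rayIntegral 0 ψ`, whose `x`-derivative is `-ψ` on `x > 0`, and move the ray integral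
onto `w` by duality. Admissible functions need not vanish at `x = 0`, so `H` also encodes zero
boundary data there. -/
lemma ae_eq_pastIntegral {k T : ℝ} {v w : ℝ × ℝ → ℝ} (hv : Integrable v) (hw : Integrable w)
    (hv0 : ∀ p : ℝ × ℝ, p.1 ≤ 0 → v p = 0)
    (H : ∀ φ, Admissible T φ → ∫ p, v p * dirDeriv (1, 0) φ p = -∫ p, w p * φ p) :
    ∀ᵐ p, p ∈ domainOfDependence k T → v p = pastIntegral 0 w p := by
  have key := (isOpen_domainOfDependence k T).ae_eq_zero_of_integral_contDiff_smul_eq_zero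
    (μ := volume) (f := fun p => v p - pastIntegral 0 w p)
    (hv.sub (Integrable.pastIntegral hw 0)).integrableOn.locallyIntegrableOn ?_
  · filter_upwards [key] with p hp hpU
    linarith [hp hpU]
  intro ψ hψ hc hU
  obtain ⟨t₀, t₁, h0, h1, hs⟩ := exists_pastSupported hc hU
  obtain ⟨C, hC⟩ := hc.exists_bound_of_continuous hψ.continuous
  have h2 := H _ ((hs.rayIntegral (Or.inl rfl)).admissible (hψ.rayIntegral 0) h0 h1)
  rw [integral_mul_rayIntegral hw hψ.continuous hC 0] at h2
  have h3 : ∫ p, v p * dirDeriv (1, 0) (rayIntegral 0 ψ) p = -∫ p, v p * ψ p := by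
    rw [← integral_neg]
    refine integral_congr_ae (Filter.Eventually.of_forall fun p => ?_)
    rcases le_or_gt p.1 0 with hp | hp
    · simp [hv0 p hp]
    · simp only [hs.dirDeriv_rayIntegral hψ hp, mul_neg]
  have i1 : Integrable fun p => v p * ψ p :=
    hv.mul_bdd hψ.continuous.aestronglyMeasurable (Filter.Eventually.of_forall hC)
  have i2 : Integrable fun p => pastIntegral 0 w p * ψ p :=
    (Integrable.pastIntegral hw 0).mul_bdd hψ.continuous.aestronglyMeasurable
      (Filter.Eventually.of_forall hC)
  calc ∫ p, ψ p • (v p - pastIntegral 0 w p) = ∫ p, (v p * ψ p - pastIntegral 0 w p * ψ p) :=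
        integral_congr_ae (Filter.Eventually.of_forall fun p => by simp only [smul_eq_mul]; ring)
    _ = 0 := by rw [integral_sub i1 i2]; linarith

/-- The test function `φ = rayIntegral k (rayIntegral 0 ψ)` solves the adjoint problem `∂ₓ D φ = ψ`,
`D φ = -rayIntegral 0 ψ` on `x > 0`, with `D` the derivative along `(1, k)`. Duality then turns the
forward integrals into backward ones. -/
lemma ae_transport_eq {k T : ℝ} {g v F : ℝ × ℝ → ℝ} (hg : Integrable g) (hv : Integrable v)
    (hF : Integrable F) (hg0 : ∀ p : ℝ × ℝ, p.1 ≤ 0 → g p = 0)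
    (hv0 : ∀ p : ℝ × ℝ, p.1 ≤ 0 → v p = 0)
    (H : ∀ φ, Admissible T φ → ∫ p, (g p * dirDeriv (1, 0) (dirDeriv (1, k) φ) p
      - v p * dirDeriv (1, k) φ p) = -∫ p, F p * φ p) :
    ∀ᵐ p, p ∈ domainOfDependence k T →
      g p = -(pastIntegral 0 v p + pastIntegral 0 (pastIntegral k F) p) := by
  have iv := Integrable.pastIntegral hv 0
  have iF := Integrable.pastIntegral (Integrable.pastIntegral hF k) 0
  have key := (isOpen_domainOfDependence k T).ae_eq_zero_of_integral_contDiff_smul_eq_zero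
    (μ := volume) (f := fun p => g p + (pastIntegral 0 v p + pastIntegral 0 (pastIntegral k F) p))
    (hg.add (iv.add iF)).integrableOn.locallyIntegrableOn ?_
  · filter_upwards [key] with p hp hpU
    linarith [hp hpU]
  intro ψ hψ hc hU
  obtain ⟨t₀, t₁, h0, h1, hs⟩ := exists_pastSupported hc hU
  obtain ⟨C, hC⟩ := hc.exists_bound_of_continuous hψ.continuous
  have hψ' := hψ.rayIntegral 0
  have hs' := hs.rayIntegral (m := 0) (Or.inl rfl)
  have hC' := rayIntegral_bound hC 0
  have h2 := H _ ((hs'.rayIntegral (m := k) (Or.inr rfl)).admissible (hψ'.rayIntegral k) h0 h1)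
  rw [integral_mul_rayIntegral hF hψ'.continuous hC' k,
    integral_mul_rayIntegral (Integrable.pastIntegral hF k) hψ.continuous hC 0] at h2
  have bd : ∀ {f : ℝ × ℝ → ℝ}, Integrable f → Integrable fun p => f p * ψ p := fun hf =>
    hf.mul_bdd hψ.continuous.aestronglyMeasurable (Filter.Eventually.of_forall hC)
  have i2 : Integrable fun p => v p * rayIntegral 0 ψ p :=
    hv.mul_bdd hψ'.continuous.aestronglyMeasurable (Filter.Eventually.of_forall hC')
  have h3 : ∫ p, (g p * dirDeriv (1, 0) (dirDeriv (1, k) (rayIntegral k (rayIntegral 0 ψ))) p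
      - v p * dirDeriv (1, k) (rayIntegral k (rayIntegral 0 ψ)) p)
      = ∫ p, (g p * ψ p + v p * rayIntegral 0 ψ p) := by
    refine integral_congr_ae (Filter.Eventually.of_forall fun p => ?_)
    rcases le_or_gt p.1 0 with hp | hp
    · simp [hv0 p hp, hg0 p hp]
    -- Equality is needed on a neighbourhood of `p`, since it is differentiated once more in `e2`.
    · have e1 : dirDeriv (1, k) (rayIntegral k (rayIntegral 0 ψ))
          =ᶠ[nhds p] fun q => -rayIntegral 0 ψ q := by
        filter_upwards [(isOpen_lt continuous_const continuous_fst).mem_nhds hp] with q hq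
        exact hs'.dirDeriv_rayIntegral hψ' hq
      have e2 : dirDeriv (1, 0) (dirDeriv (1, k) (rayIntegral k (rayIntegral 0 ψ))) p = ψ p := by
        rw [(dirDeriv_congr e1).eq_of_nhds]
        have := hs.dirDeriv_rayIntegral (m := 0) hψ hp
        unfold dirDeriv at this ⊢
        rw [fderiv_fun_neg, neg_apply, this, neg_neg]
      simp only [e2, e1.eq_of_nhds]
      ring
  rw [h3, integral_add (bd hg) i2, integral_mul_rayIntegral hv hψ.continuous hC 0] at h2
  calc ∫ p, ψ p • (g p + (pastIntegral 0 v p + pastIntegral 0 (pastIntegral k F) p))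
      = ∫ p, (g p * ψ p + (pastIntegral 0 v p * ψ p
          + pastIntegral 0 (pastIntegral k F) p * ψ p)) :=
        integral_congr_ae (Filter.Eventually.of_forall fun p => by simp only [smul_eq_mul]; ring)
    _ = 0 := by
        have i3 : Integrable fun p => pastIntegral 0 v p * ψ p
            + pastIntegral 0 (pastIntegral k F) p * ψ p := (bd iv).add (bd iF)
        rw [integral_add (bd hg) i3, integral_add (bd iv) (bd iF)]
        linarith

/-! ### The Volterra argument -/

/-- A Volterra argument along the backward rays: the solution vanishes on the domain of dependence
of the side `x = 0`. -/
theorem ae_eq_zero_on_domainOfDependence {k T b b₁ C : ℝ} (hb : b ≠ 0) (hC : 0 ≤ C)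
    {v₀ v₁ v₂ v₃ F : ℝ × ℝ → ℝ}
    (i₀ : Integrable v₀) (i₁ : Integrable v₁) (i₂ : Integrable v₂) (i₃ : Integrable v₃)
    (iF : Integrable F)
    (z₀ : ∀ p : ℝ × ℝ, p.1 ≤ 0 → v₀ p = 0) (z₁ : ∀ p : ℝ × ℝ, p.1 ≤ 0 → v₁ p = 0)
    (z₂ : ∀ p : ℝ × ℝ, p.1 ≤ 0 → v₂ p = 0) (z₃ : ∀ p : ℝ × ℝ, p.1 ≤ 0 → v₃ p = 0)
    (zF : ∀ p : ℝ × ℝ, p.1 ≤ 0 → F p = 0)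
    (hF : ∀ᵐ p, |F p| ≤ C * (|v₁ p| + |v₂ p| + |v₃ p|))
    (w₀ : ∀ φ, Admissible T φ → ∫ p, v₀ p * dirDeriv (1, 0) φ p = -∫ p, v₁ p * φ p)
    (w₁ : ∀ φ, Admissible T φ → ∫ p, v₁ p * dirDeriv (1, 0) φ p = -∫ p, v₂ p * φ p)
    (w₂ : ∀ φ, Admissible T φ → ∫ p, v₂ p * dirDeriv (1, 0) φ p = -∫ p, v₃ p * φ p)
    (w : ∀ φ, Admissible T φ →
      ∫ p, ((b * v₃ p - b₁ * v₁ p) * dirDeriv (1, 0) (dirDeriv (1, k) φ) p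
        - v₀ p * dirDeriv (1, k) φ p) = -∫ p, F p * φ p) :
    ∀ᵐ p, p ∈ domainOfDependence k T → v₀ p = 0 := by
  have e₀ := ae_eq_pastIntegral (k := k) i₀ i₁ z₀ w₀
  have e₁ := ae_eq_pastIntegral (k := k) i₁ i₂ z₁ w₁
  have e₂ := ae_eq_pastIntegral (k := k) i₂ i₃ z₂ w₂
  have e := ae_transport_eq ((i₃.const_mul b).sub (i₁.const_mul b₁)) i₀ iF
    (fun p hp => by simp [z₃ p hp, z₁ p hp]) z₀ w
  -- The three terms of `M` come from `b₁ v₁`, from `P₀ v₀` and from `P₀ P_k F`. The choice of `l`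
  -- gives `M / l < |b|`, and also `l ≥ 1`, so that backward integration never increases the norm.
  set M := |b₁| + 1 + 3 * C with hM
  have hM0 : 0 < M := by positivity
  have hb0 : 0 < |b| := abs_pos.2 hb
  set l := M / |b| + 1 with hl
  have hl1 : 1 ≤ l := by rw [hl]; linarith [div_pos hM0 hb0]
  have hl0 : 0 < l := by linarith
  set ε := ENNReal.ofReal (1 / l) with hε
  have hε1 : ε ≤ 1 := by
    rw [hε, ENNReal.ofReal_le_one, div_le_one hl0]; exact hl1
  let W := weightedNorm l k T
  have pe : ∀ {m : ℝ} {g : ℝ × ℝ → ℝ}, m = 0 ∨ m = k → Integrable g →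
      (∀ p : ℝ × ℝ, p.1 ≤ 0 → g p = 0) → W (pastIntegral m g) ≤ ε * W g := fun hm hg hg0 =>
    weightedNorm_pastIntegral_le hl0 hm hg.aestronglyMeasurable hg0
  have step : ∀ {v g : ℝ × ℝ → ℝ}, (∀ᵐ p, p ∈ domainOfDependence k T → v p = pastIntegral 0 g p) →
      Integrable g → (∀ p : ℝ × ℝ, p.1 ≤ 0 → g p = 0) → W v ≤ ε * W g := by
    intro v g hvg hg hg0
    refine le_trans (weightedNorm_mono ?_) (pe (Or.inl rfl) hg hg0)
    filter_upwards [hvg] with p hp hpU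
    rw [hp hpU]
  have n₂ := step e₂ i₃ z₃
  have n₁ := step e₁ i₂ z₂
  have n₀ := step e₀ i₁ z₁
  have le_of {x y : ℝ≥0∞} (h : x ≤ ε * y) : x ≤ y :=
    h.trans ((mul_le_mul_left hε1 y).trans (one_mul y).le)
  have m₂ : W v₂ ≤ W v₃ := le_of n₂
  have m₁ : W v₁ ≤ W v₃ := (le_of n₁).trans m₂
  have m₁' : W v₁ ≤ ε * W v₃ := n₁.trans (mul_le_mul_right m₂ ε)
  have m₀ : W v₀ ≤ W v₃ := (le_of n₀).trans m₁
  have nF : W F ≤ ENNReal.ofReal (3 * C) * W v₃ := by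
    have a1 : W F ≤ W fun p => C * (|v₁ p| + (|v₂ p| + |v₃ p|)) := by
      refine weightedNorm_mono ?_
      filter_upwards [hF] with p hp _
      rw [Real.norm_eq_abs, Real.norm_eq_abs, ← add_assoc]
      exact hp.trans (le_abs_self _)
    have aabs : ∀ v : ℝ × ℝ → ℝ, W (fun p => |v p|) ≤ W v := fun v =>
      weightedNorm_mono (Filter.Eventually.of_forall fun p _ => by simp)
    have a2 : W (fun p => C * (|v₁ p| + (|v₂ p| + |v₃ p|)))
        ≤ ENNReal.ofReal C * (W v₁ + (W v₂ + W v₃)) := by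
      simp only [W, weightedNorm_const_mul]
      rw [Real.enorm_eq_ofReal hC]
      gcongr
      refine (weightedNorm_add_le i₁.abs.aestronglyMeasurable).trans ?_
      gcongr
      · exact aabs v₁
      · refine (weightedNorm_add_le i₂.abs.aestronglyMeasurable).trans ?_
        gcongr
        · exact aabs v₂
        · exact aabs v₃
    refine (a1.trans a2).trans ?_
    calc _ ≤ ENNReal.ofReal C * (W v₃ + (W v₃ + W v₃)) := by gcongr
      _ = _ := by
        rw [ENNReal.ofReal_mul (by norm_num)]
        simp only [ENNReal.ofReal_ofNat]
        ring
  have hfin : W v₃ ≠ ⊤ := (weightedNorm_lt_top hl0.le i₃).ne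
  -- In `e`, solved for `b v₃`, every term on the right has been integrated at least once from
  -- something controlled by `v₃`, so a factor `ε` can be extracted from each.
  have main : ENNReal.ofReal |b| * W v₃ ≤ (ε * ENNReal.ofReal M) * W v₃ := by
    have b1 : ENNReal.ofReal |b| * W v₃ = W fun p => b * v₃ p := by
      simp only [W, weightedNorm_const_mul, Real.enorm_eq_ofReal_abs]
    have b2 : W (fun p => b * v₃ p) ≤ W fun p => b₁ * v₁ p +
        (-1 * pastIntegral 0 v₀ p + -1 * pastIntegral 0 (pastIntegral k F) p) := by
      refine weightedNorm_mono ?_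
      filter_upwards [e] with p hp hpU
      refine le_of_eq (congrArg _ ?_)
      have := hp hpU
      simp only [Pi.sub_apply] at this
      linarith
    have b3 : W (fun p => b₁ * v₁ p +
        (-1 * pastIntegral 0 v₀ p + -1 * pastIntegral 0 (pastIntegral k F) p))
        ≤ ENNReal.ofReal |b₁| * W v₁ + (W (pastIntegral 0 v₀)
          + W (pastIntegral 0 (pastIntegral k F))) := by
      refine (weightedNorm_add_le (i₁.const_mul b₁).aestronglyMeasurable).trans ?_
      rw [weightedNorm_const_mul, Real.enorm_eq_ofReal_abs]
      gcongr
      refine (weightedNorm_add_le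
        ((Integrable.pastIntegral i₀ 0).const_mul (-1)).aestronglyMeasurable).trans ?_
      rw [weightedNorm_const_mul, weightedNorm_const_mul]
      simp [W]
    rw [b1]
    refine (b2.trans b3).trans ?_
    calc _ ≤ ENNReal.ofReal |b₁| * (ε * W v₃) + (ε * W v₃ + ε * (ENNReal.ofReal (3 * C) * W v₃)) := by
          gcongr
          · exact (pe (Or.inl rfl) i₀ z₀).trans (mul_le_mul_right m₀ ε)
          · refine (pe (Or.inl rfl) (Integrable.pastIntegral iF k) (pastIntegral_eq_zero zF)).trans ?_
            gcongr
            exact (le_of (pe (Or.inr rfl) iF zF)).trans nF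
      _ = _ := by
        rw [hM, ENNReal.ofReal_add (by positivity) (by positivity),
          ENNReal.ofReal_add (by positivity) (by positivity), ENNReal.ofReal_one]
        ring
  -- Finiteness of `W v₃` allows it to be cancelled, leaving `|b| ≤ M / l`, against the choice of
  -- `l`.
  have hzero : W v₃ = 0 := by
    by_contra hne
    have h1 := (ENNReal.mul_le_mul_iff_left hne hfin).1 main
    rw [hε, ← ENNReal.ofReal_mul (by positivity), ENNReal.ofReal_le_ofReal_iff (by positivity),
      one_div, inv_mul_eq_div, le_div_iff₀ hl0, hl, mul_add, mul_div_cancel₀ _ hb0.ne'] at h1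
    linarith
  have : W v₀ = 0 := le_antisymm (m₀.trans hzero.le) zero_le
  exact ae_eq_zero_of_weightedNorm_eq_zero i₀.aestronglyMeasurable this

/-! ### Charts of the torus and transport of test functions -/

lemma deriv_fst_eq_dirDeriv {G : ℝ × ℝ → ℝ} (hG : ContDiff ℝ ∞ G) (x t : ℝ) :
    deriv (fun y => G (y, t)) x = dirDeriv (1, 0) G (x, t) := by
  have h1 := ((hG.differentiable (by simp)) (x, t)).hasFDerivAt
  have h2 : HasDerivAt (fun y : ℝ => ((y, t) : ℝ × ℝ)) (1, 0) x :=
    (hasDerivAt_id x).prodMk (hasDerivAt_const x t)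
  exact (h1.comp_hasDerivAt x h2).deriv

lemma deriv_snd_eq_dirDeriv {G : ℝ × ℝ → ℝ} (hG : ContDiff ℝ ∞ G) (x t : ℝ) :
    deriv (fun s => G (x, s)) t = dirDeriv (0, 1) G (x, t) := by
  have h1 := ((hG.differentiable (by simp)) (x, t)).hasFDerivAt
  have h2 : HasDerivAt (fun s : ℝ => ((x, s) : ℝ × ℝ)) (0, 1) t :=
    (hasDerivAt_const t x).prodMk (hasDerivAt_id t)
  exact (h1.comp_hasDerivAt t h2).deriv

lemma deriv_iterate_fst_eq_dirDeriv {G : ℝ × ℝ → ℝ} (hG : ContDiff ℝ ∞ G) (t : ℝ) (j : ℕ) :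
    deriv^[j] (fun y => G (y, t)) = fun x => (dirDeriv (1, 0))^[j] G (x, t) := by
  induction j with
  | zero => rfl
  | succ j ih =>
    rw [Function.iterate_succ_apply', ih]
    funext x
    rw [deriv_fst_eq_dirDeriv (hG.dirDeriv_iterate _ j), Function.iterate_succ_apply']

lemma dirDeriv_iterate_congr {d : ℝ × ℝ} {φ ψ : ℝ × ℝ → ℝ} {p : ℝ × ℝ} (h : φ =ᶠ[nhds p] ψ)
    (j : ℕ) : (dirDeriv d)^[j] φ =ᶠ[nhds p] (dirDeriv d)^[j] ψ := by
  induction j with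
  | zero => exact h
  | succ j ih => simp only [Function.iterate_succ_apply']; exact dirDeriv_congr ih

section Chart

/-- The point of the torus with coordinate `ξ` in the chart based at `y₀` with orientation `σ`. -/
noncomputable def chartPoint (y₀ : ℝ) (σ : ℤ) (ξ : ℝ) : Torus := ((y₀ + σ * ξ : ℝ) : Torus)

/-- The coordinate in `(0, 2π]` of a point of the torus. -/
noncomputable def chartCoord (y₀ : ℝ) (σ : ℤ) (x : Torus) : ℝ :=
  (AddCircle.equivIoc (2 * π) 0 (σ • (x - (y₀ : Torus))) : ℝ)

variable {y₀ : ℝ} {σ : ℤ}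

lemma chartCoord_mem (x : Torus) : chartCoord y₀ σ x ∈ Ioc 0 (2 * π) := by
  have h := (AddCircle.equivIoc (2 * π) 0 (σ • (x - (y₀ : Torus)))).2
  exact ⟨h.1, h.2.trans_eq (zero_add _)⟩

lemma chartCoord_chartPoint (hσ : σ * σ = 1) {ξ : ℝ} (hξ : ξ ∈ Ioc 0 (2 * π)) :
    chartCoord y₀ σ (chartPoint y₀ σ ξ) = ξ := by
  have hσ' : (σ : ℝ) * σ = 1 := by exact_mod_cast hσ
  have e : σ • (chartPoint y₀ σ ξ - (y₀ : Torus)) = (ξ : Torus) := by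
    unfold chartPoint
    rw [← AddCircle.coe_sub, ← AddCircle.coe_zsmul, zsmul_eq_mul]
    congr 1
    linear_combination ξ * hσ'
  unfold chartCoord
  rw [e, AddCircle.equivIoc_coe_eq (by rwa [zero_add])]

lemma chartPoint_chartCoord (hσ : σ * σ = 1) (x : Torus) :
    chartPoint y₀ σ (chartCoord y₀ σ x) = x := by
  have h1 : ((chartCoord y₀ σ x : ℝ) : Torus) = σ • (x - (y₀ : Torus)) :=
    (AddCircle.equivIoc (2 * π) 0).symm_apply_apply (σ • (x - (y₀ : Torus)))
  unfold chartPoint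
  rw [AddCircle.coe_add, ← zsmul_eq_mul, AddCircle.coe_zsmul, h1, smul_smul, hσ, one_smul]
  abel

lemma measurable_chartCoord : Measurable (chartCoord y₀ σ) := by
  have h := (AddCircle.measurableEquivIoc (2 * π) 0).measurable
  exact measurable_subtype_coe.comp
    (h.comp (by fun_prop : Continuous fun x : Torus => σ • (x - (y₀ : Torus))).measurable)

lemma continuous_chartPoint : Continuous (chartPoint y₀ σ) :=
  (AddCircle.continuous_mk' (2 * π)).comp (by fun_prop)

lemma measurePreserving_chartPoint (hσ : σ = 1 ∨ σ = -1) :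
    MeasurePreserving (chartPoint y₀ σ) (volume.restrict (Ioc 0 (2 * π))) volume := by
  have h1 := AddCircle.measurePreserving_mk (2 * π) 0
  rw [zero_add] at h1
  have h2 : MeasurePreserving (fun x : Torus => (y₀ : Torus) + σ • x) volume volume := by
    refine (measurePreserving_add_left volume (y₀ : Torus)).comp ?_
    rcases hσ with rfl | rfl
    · have e : (fun x : Torus => (1 : ℤ) • x) = id := funext fun x => one_zsmul x
      change MeasurePreserving (fun x : Torus => (1 : ℤ) • x) volume volume
      rw [e]
      exact MeasurePreserving.id (volume : Measure Torus)
    · have e : (fun x : Torus => (-1 : ℤ) • x) = Neg.neg := funext fun x => neg_one_zsmul x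
      change MeasurePreserving (fun x : Torus => (-1 : ℤ) • x) volume volume
      rw [e]
      exact Measure.measurePreserving_neg (volume : Measure Torus)
  have h3 := h2.comp h1
  have e : (fun x : Torus => (y₀ : Torus) + σ • x) ∘ ((↑) : ℝ → Torus) = chartPoint y₀ σ := by
    funext ξ
    simp only [Function.comp_apply, chartPoint]
    rw [AddCircle.coe_add, ← zsmul_eq_mul, AddCircle.coe_zsmul]
  rwa [e] at h3

lemma measurePreserving_chartCoord (hσ : σ = 1 ∨ σ = -1) :
    MeasurePreserving (chartCoord y₀ σ) volume (volume.restrict (Ioc 0 (2 * π))) := by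
  refine ⟨measurable_chartCoord, ?_⟩
  have hσ' : σ * σ = 1 := by rcases hσ with rfl | rfl <;> norm_num
  rw [← (measurePreserving_chartPoint (y₀ := y₀) hσ).map_eq,
    Measure.map_map measurable_chartCoord continuous_chartPoint.measurable]
  have : chartCoord y₀ σ ∘ chartPoint y₀ σ =ᵐ[volume.restrict (Ioc 0 (2 * π))] id := by
    filter_upwards [ae_restrict_mem measurableSet_Ioc] with ξ hξ
    exact chartCoord_chartPoint hσ' hξ
  rw [Measure.map_congr this, Measure.map_id]

/-- Transport of a function on the plane to the torus through the chart. -/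
noncomputable def toTorus (y₀ : ℝ) (σ : ℤ) (g : ℝ × ℝ → ℝ) (x : Torus) (t : ℝ) : ℝ :=
  g (chartCoord y₀ σ x, t)

/-- Near a given point the coordinate is affine up to a jump of one period. A jump can occur only
within `δ` of the ends of the chart, where `g` vanishes on both sides. -/
lemma contDiff_toTorus (hσ : σ = 1 ∨ σ = -1) {g : ℝ × ℝ → ℝ} (hg : ContDiff ℝ ∞ g) {δ : ℝ}
    (hδ : 0 < δ) (h0 : ∀ p : ℝ × ℝ, p.1 ∉ Ioo δ (2 * π - δ) → g p = 0) :
    ContDiff ℝ ∞ fun y : ℝ × ℝ => toTorus y₀ σ g (y.1 : Torus) y.2 := by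
  have hσ1 : σ * σ = 1 := by rcases hσ with rfl | rfl <;> norm_num
  have hσ2 : (σ : ℝ) * σ = 1 := by exact_mod_cast hσ1
  have hσ3 : |(σ : ℝ)| = 1 := by rcases hσ with rfl | rfl <;> simp
  rw [contDiff_iff_contDiffAt]
  intro y
  set ξ := chartCoord y₀ σ (y.1 : Torus) with hξ
  have hξm : ξ ∈ Ioc 0 (2 * π) := chartCoord_mem _
  have key : (fun z : ℝ × ℝ => toTorus y₀ σ g (z.1 : Torus) z.2)
      =ᶠ[nhds y] fun z => g (ξ + σ * (z.1 - y.1), z.2) := by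
    have hopen : ∀ᶠ z : ℝ × ℝ in nhds y, |z.1 - y.1| < min δ (2 * π) := by
      have hc : Continuous fun z : ℝ × ℝ => |z.1 - y.1| := by fun_prop
      refine hc.continuousAt.eventually_lt continuousAt_const ?_
      simpa using ⟨hδ, Real.pi_pos⟩
    filter_upwards [hopen] with z hz
    have hz' : |(σ : ℝ) * (z.1 - y.1)| < min δ (2 * π) := by rwa [abs_mul, hσ3, one_mul]
    set η := (σ : ℝ) * (z.1 - y.1) with hη
    obtain ⟨hz1, hz2⟩ := abs_lt.1 hz'
    have m1 := min_le_left δ (2 * π)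
    have m2 := min_le_right δ (2 * π)
    have hpt : (z.1 : Torus) = chartPoint y₀ σ (ξ + η) := by
      have h1 : chartPoint y₀ σ ξ = (y.1 : Torus) := chartPoint_chartCoord hσ1 _
      have h2 : chartPoint y₀ σ (ξ + η) = chartPoint y₀ σ ξ + ((z.1 - y.1 : ℝ) : Torus) := by
        unfold chartPoint
        rw [← AddCircle.coe_add]
        congr 1
        rw [hη]
        linear_combination (z.1 - y.1) * hσ2
      rw [h2, h1, ← AddCircle.coe_add]
      congr 1
      ring
    have hper : ∀ n : ℤ, chartPoint y₀ σ (ξ + η + n * (2 * π)) = chartPoint y₀ σ (ξ + η) := by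
      intro n
      unfold chartPoint
      rw [show y₀ + σ * (ξ + η + n * (2 * π)) = (y₀ + σ * (ξ + η)) + (σ * n : ℤ) • (2 * π) by
        rw [zsmul_eq_mul]; push_cast; ring]
      rw [AddCircle.coe_add, AddCircle.coe_zsmul, AddCircle.coe_period, smul_zero, add_zero]
    change g (chartCoord y₀ σ (z.1 : Torus), z.2) = g (ξ + η, z.2)
    rw [hpt]
    rcases le_or_gt (ξ + η) 0 with h | h
    · rw [← hper 1, chartCoord_chartPoint hσ1 (by
        push_cast; constructor <;> linarith [hξm.1, hξm.2])]
      rw [h0, h0]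
      · simp only [mem_Ioo, not_and_or, not_lt]; left; linarith
      · push_cast
        simp only [mem_Ioo, not_and_or, not_lt]; right; linarith [hξm.1]
    · rcases le_or_gt (ξ + η) (2 * π) with h' | h'
      · rw [chartCoord_chartPoint hσ1 ⟨h, h'⟩]
      · rw [← hper (-1), chartCoord_chartPoint hσ1 (by
          push_cast; constructor <;> linarith [hξm.1, hξm.2])]
        rw [h0, h0]
        · simp only [mem_Ioo, not_and_or, not_lt]; right; linarith
        · push_cast
          simp only [mem_Ioo, not_and_or, not_lt]; left; linarith [hξm.2]
  refine ContDiffAt.congr_of_eventuallyEq ?_ key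
  exact (hg.comp (by fun_prop : ContDiff ℝ ∞ fun z : ℝ × ℝ =>
    ((ξ + σ * (z.1 - y.1), z.2) : ℝ × ℝ))).contDiffAt

lemma torusDeriv_chartPoint (hσ : σ * σ = 1) (f : Torus → ℝ) (ξ : ℝ) :
    torusDeriv f (chartPoint y₀ σ ξ) = σ * deriv (fun η => f (chartPoint y₀ σ η)) ξ := by
  have hσ' : (σ : ℝ) * σ = 1 := by exact_mod_cast hσ
  have e : (fun h : ℝ => f (chartPoint y₀ σ ξ + (h : Torus)))
      = fun h : ℝ => (fun η => f (chartPoint y₀ σ (ξ + η))) (σ * h) := by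
    funext h
    congr 1
    unfold chartPoint
    rw [← AddCircle.coe_add]
    congr 1
    linear_combination -h * hσ'
  unfold torusDeriv
  rw [e, deriv_comp_mul_left (σ : ℝ) (fun η => f (chartPoint y₀ σ (ξ + η))), deriv_comp_const_add (fun η => f (chartPoint y₀ σ η))]
  simp

lemma torusDeriv_iterate_chartPoint (hσ : σ * σ = 1) (f : Torus → ℝ) (j : ℕ) (ξ : ℝ) :
    torusDeriv^[j] f (chartPoint y₀ σ ξ)
      = (σ : ℝ) ^ j * deriv^[j] (fun η => f (chartPoint y₀ σ η)) ξ := by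
  induction j generalizing ξ with
  | zero => simp
  | succ j ih =>
    rw [Function.iterate_succ_apply', torusDeriv_chartPoint hσ, Function.iterate_succ_apply']
    simp_rw [ih]
    rw [deriv_const_mul_field, pow_succ]
    ring

lemma dX_toTorus (hσ : σ * σ = 1) {g : ℝ × ℝ → ℝ} (hg : ContDiff ℝ ∞ g) (j : ℕ) {ξ : ℝ}
    (hξ : ξ ∈ Ioo 0 (2 * π)) (t : ℝ) :
    dX j (toTorus y₀ σ g) (chartPoint y₀ σ ξ) t
      = (σ : ℝ) ^ j * (dirDeriv (1, 0))^[j] g (ξ, t) := by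
  unfold dX
  rw [torusDeriv_iterate_chartPoint hσ]
  congr 1
  have h1 : (fun η => toTorus y₀ σ g (chartPoint y₀ σ η) t) =ᶠ[nhds ξ] fun η => g (η, t) := by
    filter_upwards [isOpen_Ioo.mem_nhds hξ] with η hη
    unfold toTorus
    rw [chartCoord_chartPoint hσ ⟨hη.1, hη.2.le⟩]
  rw [← iteratedDeriv_eq_iterate, (h1.iteratedDeriv j).eq_of_nhds, iteratedDeriv_eq_iterate,
    deriv_iterate_fst_eq_dirDeriv hg]

lemma dTX_toTorus (hσ : σ * σ = 1) {g : ℝ × ℝ → ℝ} (hg : ContDiff ℝ ∞ g) (j : ℕ) {ξ : ℝ}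
    (hξ : ξ ∈ Ioo 0 (2 * π)) (t : ℝ) :
    dTX j (toTorus y₀ σ g) (chartPoint y₀ σ ξ) t
      = (σ : ℝ) ^ j * dirDeriv (0, 1) ((dirDeriv (1, 0))^[j] g) (ξ, t) := by
  unfold dTX
  simp_rw [dX_toTorus hσ hg j hξ]
  rw [deriv_const_mul_field, deriv_snd_eq_dirDeriv (hg.dirDeriv_iterate _ j)]

/-- An admissible function on the plane agrees, away from `x = 0` and `x = 2π`, with the lift of a
test function on the torus. -/
lemma exists_testFunction (hσ : σ = 1 ∨ σ = -1) {T : ℝ} {φ : ℝ × ℝ → ℝ} (hφ : Admissible T φ)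
    {ε : ℝ} (hε : 0 < ε) (hεπ : ε < π) :
    ∃ Φ : Torus → ℝ → ℝ, IsTestFunction T Φ ∧ (∀ t, TorusSmooth fun x => Φ x t) ∧
      (∀ j, ∀ ξ ∈ Ioo ε (2 * π - ε), ∀ t,
        dX j Φ (chartPoint y₀ σ ξ) t = (σ : ℝ) ^ j * (dirDeriv (1, 0))^[j] φ (ξ, t)) ∧
      (∀ j, ∀ ξ ∈ Ioo ε (2 * π - ε), ∀ t, dTX j Φ (chartPoint y₀ σ ξ) t
        = (σ : ℝ) ^ j * dirDeriv (0, 1) ((dirDeriv (1, 0))^[j] φ) (ξ, t)) := by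
  have hσ1 : σ * σ = 1 := by rcases hσ with rfl | rfl <;> norm_num
  obtain ⟨hφs, t₀, t₁, h0, h1, hsupp⟩ := hφ
  -- Centred at `π`, the two balls are `(ε, 2π - ε)` and `(ε/2, 2π - ε/2)`.
  let χ : ContDiffBump (π : ℝ) := ⟨π - ε, π - ε / 2, by linarith, by linarith⟩
  let g : ℝ × ℝ → ℝ := fun p => χ p.1 * φ p
  have hg : ContDiff ℝ ∞ g := (χ.contDiff.comp contDiff_fst).mul hφs
  have hg0 : ∀ p : ℝ × ℝ, p.1 ∉ Ioo (ε / 2) (2 * π - ε / 2) → g p = 0 := by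
    intro p hp
    have : χ p.1 = 0 := by
      rw [← Function.notMem_support, χ.support_eq, Real.ball_eq_Ioo]
      convert hp using 3 <;> simp only [χ] <;> ring
    simp [g, this]
  have hgeq : ∀ ξ ∈ Ioo ε (2 * π - ε), ∀ t, g =ᶠ[nhds (ξ, t)] φ := by
    intro ξ hξ t
    have : IsOpen (Prod.fst ⁻¹' Ioo ε (2 * π - ε) : Set (ℝ × ℝ)) :=
      isOpen_Ioo.preimage continuous_fst
    filter_upwards [this.mem_nhds (show (ξ, t) ∈ _ from hξ)] with q hq
    have : χ q.1 = 1 := by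
      apply χ.one_of_mem_closedBall
      rw [Real.closedBall_eq_Icc]
      simp only [χ]
      constructor <;> linarith [hq.1, hq.2]
    simp [g, this]
  have hsm := contDiff_toTorus (y₀ := y₀) hσ hg (half_pos hε) hg0
  refine ⟨toTorus y₀ σ g, ⟨hsm, Icc t₀ t₁, isCompact_Icc, ?_, ?_⟩, ?_, ?_, ?_⟩
  · exact fun s hs => ⟨h0.trans_le hs.1, hs.2.trans_lt h1⟩
  · intro x t ht
    by_contra hne
    have h2 : chartCoord y₀ σ x ∈ Ioo (ε / 2) (2 * π - ε / 2) := by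
      by_contra hcon
      exact hne (hg0 _ hcon)
    refine ht (hsupp (chartCoord y₀ σ x, t) ⟨by linarith [h2.1], by linarith [h2.2]⟩ ?_)
    exact fun h => hne (by simp [toTorus, g, h])
  · intro t
    have hl : ContDiff ℝ ∞ fun y : ℝ => ((y, t) : ℝ × ℝ) := by fun_prop
    have hcomp := hsm.comp hl
    exact hcomp
  · intro j ξ hξ t
    rw [dX_toTorus hσ1 hg j ⟨hε.trans hξ.1, by linarith [hξ.2]⟩,
      (dirDeriv_iterate_congr (hgeq ξ hξ t) j).eq_of_nhds]
  · intro j ξ hξ t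
    rw [dTX_toTorus hσ1 hg j ⟨hε.trans hξ.1, by linarith [hξ.2]⟩,
      (dirDeriv_congr (dirDeriv_iterate_congr (hgeq ξ hξ t) j)).eq_of_nhds]

end Chart

/-! ### Weak derivatives on the torus -/

lemma tsupport_torusDeriv_subset (f : Torus → ℝ) : tsupport (torusDeriv f) ⊆ tsupport f := by
  refine closure_minimal (fun x hx => ?_) (isClosed_tsupport f)
  by_contra hcon
  refine hx ?_
  have h1 : f =ᶠ[nhds x] 0 := notMem_tsupport_iff_eventuallyEq.1 hcon
  have h2 : Filter.Tendsto (fun h : ℝ => x + (h : Torus)) (nhds 0) (nhds x) := by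
    have : Continuous fun h : ℝ => x + (h : Torus) :=
      continuous_const.add (AddCircle.continuous_mk' (2 * π))
    simpa using this.tendsto 0
  have h3 : (fun h : ℝ => f (x + (h : Torus))) =ᶠ[nhds 0] fun _ => 0 := h2.eventually h1
  unfold torusDeriv
  rw [h3.deriv_eq]
  simp

lemma tsupport_torusDeriv_iterate_subset (f : Torus → ℝ) (j : ℕ) :
    tsupport (torusDeriv^[j] f) ⊆ tsupport f := by
  induction j with
  | zero => exact subset_rfl
  | succ j ih =>
    rw [Function.iterate_succ_apply']
    exact (tsupport_torusDeriv_subset _).trans ih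

/-- The fundamental lemma of the calculus of variations on the torus. -/
lemma torus_ae_eq_zero {f : Torus → ℝ} (hf : Integrable f) {O : Set Torus} (hO : IsOpen O)
    (H : ∀ φ : Torus → ℝ, TorusSmooth φ → tsupport φ ⊆ O → ∫ x, f x * φ x = 0) :
    ∀ᵐ x, x ∈ O → f x = 0 := by
  have hσ : (1 : ℤ) = 1 ∨ (1 : ℤ) = -1 := Or.inl rfl
  let P : ℝ → Torus := chartPoint 0 1
  have mp := measurePreserving_chartPoint (y₀ := 0) hσ
  have mc := measurePreserving_chartCoord (y₀ := 0) hσ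
  -- The open chart misses only the point `ξ = 2π`, which is null.
  let S : Set ℝ := Ioo 0 (2 * π) ∩ P ⁻¹' O
  have hS : IsOpen S := isOpen_Ioo.inter (hO.preimage continuous_chartPoint)
  have hfP : IntegrableOn (fun ξ => f (P ξ)) (Ioc 0 (2 * π)) := mp.integrable_comp_of_integrable hf
  have key := hS.ae_eq_zero_of_integral_contDiff_smul_eq_zero (μ := volume)
    (f := fun ξ => f (P ξ))
    (hfP.mono_set (inter_subset_left.trans Ioo_subset_Ioc_self)).locallyIntegrableOn ?_
  · have h1 : ∀ᵐ ξ ∂(volume.restrict (Ioc 0 (2 * π))), P ξ ∈ O → f (P ξ) = 0 := by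
      rw [← Measure.restrict_congr_set (Ioo_ae_eq_Ioc (μ := volume) (a := 0) (b := 2 * π)),
        ae_restrict_iff' measurableSet_Ioo]
      filter_upwards [key] with ξ h hξ hO'
      exact h ⟨hξ, hO'⟩
    have h2 := mc.quasiMeasurePreserving.ae h1
    filter_upwards [h2] with x hx
    rwa [show P (chartCoord 0 1 x) = x from chartPoint_chartCoord (by norm_num) x] at hx
  intro φ hφ hc hsub
  obtain ⟨a, b, ha, hb, hab⟩ := hc.isCompact.exists_subset_Icc (hsub.trans inter_subset_left)
  let δ := min a (2 * π - b) / 2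
  have hδ : 0 < δ := half_pos (lt_min ha (by linarith))
  have hδa : δ < a := by have := min_le_left a (2 * π - b); simp only [δ]; linarith
  have hδb : b < 2 * π - δ := by
    have := min_le_right a (2 * π - b)
    have : δ < 2 * π - b := by simp only [δ]; linarith
    linarith
  let g : ℝ × ℝ → ℝ := fun p => φ p.1
  have hsm := contDiff_toTorus (y₀ := 0) hσ (g := g) (hφ.comp contDiff_fst) hδ (by
    intro p hp
    by_contra hne
    have := hab (subset_tsupport φ hne)
    exact hp ⟨hδa.trans_le this.1, this.2.trans_lt hδb⟩)
  have hst : TorusSmooth fun x => φ (chartCoord 0 1 x) :=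
    hsm.comp (by fun_prop : ContDiff ℝ ∞ fun y : ℝ => ((y, 0) : ℝ × ℝ))
  have hts : tsupport (fun x => φ (chartCoord 0 1 x)) ⊆ O := by
    have hcl : IsClosed (P '' tsupport φ) :=
      (hc.isCompact.image continuous_chartPoint).isClosed
    have h : P '' tsupport φ ⊆ O := image_subset_iff.2 (hsub.trans inter_subset_right)
    refine Subset.trans (closure_minimal (fun x hx => ?_) hcl) h
    exact ⟨chartCoord 0 1 x, subset_tsupport φ hx, chartPoint_chartCoord (by norm_num) x⟩
  have h3 := H _ hst hts
  have hfm : AEStronglyMeasurable (fun ξ => f (P ξ) * φ ξ) (volume.restrict (Ioc 0 (2 * π))) :=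
    hfP.aestronglyMeasurable.mul hφ.continuous.aestronglyMeasurable
  have h4 : ∫ x, f x * φ (chartCoord 0 1 x) = ∫ ξ in Ioc 0 (2 * π), f (P ξ) * φ ξ := by
    rw [← mc.map_eq] at hfm ⊢
    rw [integral_map mc.measurable.aemeasurable hfm]
    refine integral_congr_ae (Filter.Eventually.of_forall fun x => ?_)
    simp only [P, chartPoint_chartCoord (σ := 1) (by norm_num)]
  rw [h4] at h3
  rw [← h3, ← setIntegral_eq_integral_of_forall_compl_eq_zero (s := Ioc 0 (2 * π))]
  · exact integral_congr_ae (Filter.Eventually.of_forall fun ξ => by simp [mul_comm])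
  · intro ξ hξ
    have : φ ξ = 0 := by
      by_contra hne
      exact hξ (Ioo_subset_Ioc_self (hsub (subset_tsupport φ hne)).1)
    simp [this]

instance isFiniteMeasure_timeMeasure (T : ℝ) : IsFiniteMeasure (timeMeasure T) := by
  unfold timeMeasure; infer_instance

instance isFiniteMeasure_spaceTimeMeasure (T : ℝ) : IsFiniteMeasure (spaceTimeMeasure T) := by
  unfold spaceTimeMeasure; infer_instance

lemma TorusSmooth.continuous {φ : Torus → ℝ} (h : TorusSmooth φ) : Continuous φ :=
  (QuotientAddGroup.isQuotientMap_mk (N := AddSubgroup.zmultiples (2 * π))).continuous_iff.2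
    (ContDiff.continuous h)

lemma TorusSmooth.integrable_mul {φ f : Torus → ℝ} (h : TorusSmooth φ) (hf : Integrable f) :
    Integrable fun x => f x * φ x := by
  obtain ⟨C, hC⟩ := isCompact_univ.exists_bound_of_continuousOn h.continuous.continuousOn
  exact hf.mul_bdd h.continuous.aestronglyMeasurable
    (Filter.Eventually.of_forall fun x => hC x (mem_univ x))

lemma IsWeakDeriv.integrable_right {j : ℕ} {f g : Torus → ℝ} (h : IsWeakDeriv j f g) :
    Integrable g :=
  h.2.1.integrable one_le_two

/-- The derivatives in `IsWeakSolution` and those in `MemLpSobolev` are separate existential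
witnesses; this identifies them slice by slice. -/
lemma IsWeakDeriv.unique {j : ℕ} {f g g' : Torus → ℝ} (h : IsWeakDeriv j f g)
    (h' : IsWeakDeriv j f g') : g =ᵐ[volume] g' := by
  have := torus_ae_eq_zero (h.integrable_right.sub h'.integrable_right) isOpen_univ
    (fun φ hφ _ => by
      have h1 := (h.2.2 φ hφ).symm.trans (h'.2.2 φ hφ)
      have h2 := mul_left_cancel₀ (pow_ne_zero j (by norm_num : (-1 : ℝ) ≠ 0)) h1
      simp only [Pi.sub_apply, sub_mul]
      rw [integral_sub (hφ.integrable_mul h.integrable_right)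
        (hφ.integrable_mul h'.integrable_right), h2, sub_self])
  filter_upwards [this] with x hx
  exact sub_eq_zero.1 (hx (mem_univ x))

lemma IsWeakDeriv.ae_eq_zero_on {j : ℕ} {f g : Torus → ℝ} (h : IsWeakDeriv j f g) {O : Set Torus}
    (hO : IsOpen O) (hf : ∀ᵐ x, x ∈ O → f x = 0) : ∀ᵐ x, x ∈ O → g x = 0 := by
  refine torus_ae_eq_zero h.integrable_right hO fun φ hφ hsupp => ?_
  have h1 : ∫ x, f x * torusDeriv^[j] φ x = 0 := by
    refine integral_eq_zero_of_ae ?_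
    filter_upwards [hf] with x hx
    by_cases hxO : x ∈ O
    · simp [hx hxO]
    · have : torusDeriv^[j] φ x = 0 := by
        by_contra hne
        exact hxO (hsupp (tsupport_torusDeriv_iterate_subset φ j (subset_tsupport _ hne)))
      simp [this]
  have h2 := h.2.2 φ hφ
  rw [h1] at h2
  simpa using h2.symm

lemma ae_slice_eq_zero {T : ℝ} {u : Torus → ℝ → ℝ} {O : Set Torus}
    (hvan : ∀ᵐ z ∂(spaceTimeMeasure T), z.1 ∈ O → u z.1 z.2 = 0) :
    ∀ᵐ t ∂(timeMeasure T), ∀ᵐ x, x ∈ O → u x t = 0 :=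
  Measure.ae_ae_of_ae_prod
    ((Measure.measurePreserving_swap (μ := timeMeasure T) (ν := (volume : Measure Torus)))
      |>.quasiMeasurePreserving.ae hvan)

/-- On almost every time slice a weak derivative vanishes wherever the function does, by locality of
derivatives of test functions. Joint measurability of `v` and Tonelli make this a statement in
space-time. -/
lemma IsWeakSpaceDeriv.ae_eq_zero_on {T : ℝ} {j : ℕ} {u v : Torus → ℝ → ℝ}
    (h : IsWeakSpaceDeriv T j u v) {O : Set Torus} (hO : IsOpen O)
    (hvan : ∀ᵐ z ∂(spaceTimeMeasure T), z.1 ∈ O → u z.1 z.2 = 0) :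
    ∀ᵐ z ∂(spaceTimeMeasure T), z.1 ∈ O → v z.1 z.2 = 0 := by
  have hm : MeasurableSet (Prod.fst ⁻¹' O : Set (Torus × ℝ)) := measurable_fst hO.measurableSet
  have hae : AEMeasurable (fun z : Torus × ℝ => ‖(Prod.fst ⁻¹' O).indicator
      (Function.uncurry v) z‖ₑ) (spaceTimeMeasure T) := (h.2.1.indicator hm).enorm
  have h0 : ∫⁻ z, ‖(Prod.fst ⁻¹' O).indicator (Function.uncurry v) z‖ₑ ∂(spaceTimeMeasure T)
      = 0 := by
    unfold spaceTimeMeasure at hae ⊢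
    rw [lintegral_prod_symm _ hae]
    refine (lintegral_congr_ae ?_).trans lintegral_zero
    filter_upwards [h.2.2, ae_slice_eq_zero hvan] with t ht ht'
    refine (lintegral_congr_ae ?_).trans lintegral_zero
    filter_upwards [ht.ae_eq_zero_on hO ht'] with x hx
    by_cases hxO : x ∈ O
    · simp [indicator, hxO, Function.uncurry, hx hxO]
    · simp [indicator, hxO]
  rw [lintegral_eq_zero_iff' hae] at h0
  filter_upwards [h0] with z hz hzO
  simpa [indicator, hzO, Function.uncurry] using hz

/-- Both alternatives for `u` in the theorem enter only through this: the measures are finite, so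
`L²` in space and `L^q` in time embed into `L¹`. -/
lemma MemLpSobolev.integrable {T : ℝ} {q : ℝ≥0∞} (hq : 1 ≤ q) {k j : ℕ} (hj : j ≤ k)
    {u w : Torus → ℝ → ℝ} (h : MemLpSobolev q k T u) (hw : IsWeakSpaceDeriv T j u w) :
    Integrable (Function.uncurry w) (spaceTimeMeasure T) := by
  obtain ⟨v, hv, hvL⟩ := h j hj
  refine ⟨hw.2.1, ?_⟩
  have hae := hw.2.1.enorm
  have hint : Integrable (fun t => (eLpNorm (fun x => v x t) 2 volume).toReal) (timeMeasure T) :=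
    hvL.integrable hq
  unfold HasFiniteIntegral
  unfold spaceTimeMeasure at hae ⊢
  rw [lintegral_prod_symm _ hae]
  let c : ℝ≥0∞ := (volume (univ : Set Torus)) ^ ((1 : ℝ) - 1 / 2)
  have hc : c ≠ ⊤ := ENNReal.rpow_ne_top_of_nonneg (by norm_num) (measure_ne_top _ _)
  have hle : ∀ᵐ t ∂(timeMeasure T), ∫⁻ x, ‖Function.uncurry w (x, t)‖ₑ
      ≤ ‖(eLpNorm (fun x => v x t) 2 volume).toReal‖ₑ * c := by
    filter_upwards [hw.2.2, hv.2.2] with t ht ht'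
    have h1 : ∫⁻ x, ‖Function.uncurry w (x, t)‖ₑ = ∫⁻ x, ‖v x t‖ₑ := by
      refine lintegral_congr_ae ?_
      filter_upwards [ht.unique ht'] with x hx
      simp [Function.uncurry, hx]
    rw [h1, ← eLpNorm_one_eq_lintegral_enorm, Real.enorm_eq_ofReal ENNReal.toReal_nonneg,
      ENNReal.ofReal_toReal ht'.2.1.2.ne]
    have := eLpNorm_le_eLpNorm_mul_rpow_measure_univ (p := 1) (q := 2) one_le_two
      ht'.2.1.1
    simpa [c] using this
  refine (lintegral_mono_ae hle).trans_lt ?_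
  rw [lintegral_mul_const' _ _ hc]
  exact ENNReal.mul_lt_top hint.2 hc.lt_top

/-! ### Test functions on the space-time torus -/

lemma torusDeriv_iterate_coe (f : Torus → ℝ) (j : ℕ) (y : ℝ) :
    torusDeriv^[j] f (y : Torus) = deriv^[j] (fun η : ℝ => f (η : Torus)) y := by
  have := torusDeriv_iterate_chartPoint (y₀ := 0) (σ := 1) (by norm_num) f j y
  simpa [chartPoint] using this

lemma continuous_of_continuous_lift {G : Torus × ℝ → ℝ}
    (h : Continuous fun y : ℝ × ℝ => G ((y.1 : Torus), y.2)) : Continuous G := by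
  have h1 : IsOpenQuotientMap ((↑) : ℝ → Torus) := QuotientAddGroup.isOpenQuotientMap_mk
  exact (h1.prodMap (IsOpenQuotientMap.id (X := ℝ))).isQuotientMap.continuous_iff.2 h

namespace IsTestFunction

variable {T : ℝ} {Φ : Torus → ℝ → ℝ}

lemma dX_coe (h : IsTestFunction T Φ) (j : ℕ) (y t : ℝ) :
    dX j Φ (y : Torus) t
      = (dirDeriv (1, 0))^[j] (fun z : ℝ × ℝ => Φ (z.1 : Torus) z.2) (y, t) := by
  unfold dX
  rw [torusDeriv_iterate_coe]
  exact congrFun (deriv_iterate_fst_eq_dirDeriv h.1 t j) y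

lemma dTX_coe (h : IsTestFunction T Φ) (j : ℕ) (y t : ℝ) :
    dTX j Φ (y : Torus) t = dirDeriv (0, 1)
      ((dirDeriv (1, 0))^[j] (fun z : ℝ × ℝ => Φ (z.1 : Torus) z.2)) (y, t) := by
  unfold dTX
  simp_rw [h.dX_coe j]
  exact deriv_snd_eq_dirDeriv (h.1.dirDeriv_iterate _ j) y t

lemma continuous_dX (h : IsTestFunction T Φ) (j : ℕ) :
    Continuous fun z : Torus × ℝ => dX j Φ z.1 z.2 := by
  refine continuous_of_continuous_lift ?_
  simp_rw [h.dX_coe j]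
  exact (h.1.dirDeriv_iterate _ j).continuous

lemma continuous_dTX (h : IsTestFunction T Φ) (j : ℕ) :
    Continuous fun z : Torus × ℝ => dTX j Φ z.1 z.2 := by
  refine continuous_of_continuous_lift ?_
  simp_rw [h.dTX_coe j]
  exact ((h.1.dirDeriv_iterate _ j).dirDeriv _).continuous

lemma bounded_of_continuous {G : Torus × ℝ → ℝ} (hG : Continuous G) {K : Set ℝ}
    (hK : IsCompact K) (h0 : ∀ z, z.2 ∉ K → G z = 0) : ∃ C, ∀ z, ‖G z‖ ≤ C := by
  obtain ⟨C, hC⟩ := (isCompact_univ.prod hK).exists_bound_of_continuousOn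
    (hG.continuousOn (s := (univ : Set Torus) ×ˢ K))
  refine ⟨max C 0, fun z => ?_⟩
  by_cases hz : z.2 ∈ K
  · exact (hC z ⟨mem_univ _, hz⟩).trans (le_max_left _ _)
  · rw [h0 z hz, norm_zero]; exact le_max_right _ _

lemma dX_eq_zero {K : Set ℝ} (h0 : ∀ x t, t ∉ K → Φ x t = 0) (j : ℕ) (x : Torus) {t : ℝ}
    (ht : t ∉ K) : dX j Φ x t = 0 := by
  have h1 : (fun y => Φ y t) = fun _ => 0 := funext fun y => h0 y t ht
  have h2 : tsupport (torusDeriv^[j] fun _ : Torus => (0 : ℝ)) ⊆ ∅ :=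
    (tsupport_torusDeriv_iterate_subset _ j).trans (by simp [tsupport, Function.support])
  unfold dX
  rw [h1]
  by_contra hne
  exact h2 (subset_tsupport _ hne)

lemma bounded_dX (h : IsTestFunction T Φ) (j : ℕ) :
    ∃ C, ∀ z : Torus × ℝ, ‖dX j Φ z.1 z.2‖ ≤ C := by
  obtain ⟨K, hK, -, h0⟩ := h.2
  exact bounded_of_continuous (h.continuous_dX j) hK fun z hz => dX_eq_zero h0 j z.1 hz

lemma bounded_dTX (h : IsTestFunction T Φ) (j : ℕ) :
    ∃ C, ∀ z : Torus × ℝ, ‖dTX j Φ z.1 z.2‖ ≤ C := by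
  obtain ⟨K, hK, -, h0⟩ := h.2
  refine bounded_of_continuous (h.continuous_dTX j) hK fun z hz => ?_
  have : (fun s => dX j Φ z.1 s) =ᶠ[nhds z.2] fun _ => 0 := by
    filter_upwards [hK.isClosed.isOpen_compl.mem_nhds hz] with s hs
    exact dX_eq_zero h0 j z.1 hs
  unfold dTX
  rw [this.deriv_eq]
  simp

lemma integrable_mul_dX (h : IsTestFunction T Φ) (j : ℕ) {f : Torus × ℝ → ℝ}
    (hf : Integrable f (spaceTimeMeasure T)) :
    Integrable (fun z => f z * dX j Φ z.1 z.2) (spaceTimeMeasure T) := by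
  obtain ⟨C, hC⟩ := h.bounded_dX j
  exact hf.mul_bdd (h.continuous_dX j).aestronglyMeasurable (Filter.Eventually.of_forall hC)

lemma integrable_mul_dTX (h : IsTestFunction T Φ) (j : ℕ) {f : Torus × ℝ → ℝ}
    (hf : Integrable f (spaceTimeMeasure T)) :
    Integrable (fun z => f z * dTX j Φ z.1 z.2) (spaceTimeMeasure T) := by
  obtain ⟨C, hC⟩ := h.bounded_dTX j
  exact hf.mul_bdd (h.continuous_dTX j).aestronglyMeasurable (Filter.Eventually.of_forall hC)

end IsTestFunction

lemma integral_mul_dX {T : ℝ} {Φ : Torus → ℝ → ℝ} (hΦ : IsTestFunction T Φ)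
    (hsm : ∀ t, TorusSmooth fun x => Φ x t) {j : ℕ} {u w : Torus → ℝ → ℝ}
    (h : IsWeakSpaceDeriv T j u w) (hu : Integrable (Function.uncurry u) (spaceTimeMeasure T))
    (hw : Integrable (Function.uncurry w) (spaceTimeMeasure T)) :
    ∫ z, u z.1 z.2 * dX j Φ z.1 z.2 ∂(spaceTimeMeasure T)
      = (-1) ^ j * ∫ z, w z.1 z.2 * dX 0 Φ z.1 z.2 ∂(spaceTimeMeasure T) := by
  have i1 : Integrable (fun z : Torus × ℝ => u z.1 z.2 * dX j Φ z.1 z.2) (spaceTimeMeasure T) :=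
    hΦ.integrable_mul_dX j hu
  have i2 : Integrable (fun z : Torus × ℝ => w z.1 z.2 * dX 0 Φ z.1 z.2) (spaceTimeMeasure T) :=
    hΦ.integrable_mul_dX 0 hw
  unfold spaceTimeMeasure at i1 i2 ⊢
  rw [integral_prod_symm _ i1, integral_prod_symm _ i2, ← integral_const_mul]
  refine integral_congr_ae ?_
  filter_upwards [h.2.2] with t ht
  exact ht.2.2 _ (hsm t)

lemma volume_restrict_cell (T : ℝ) : (volume : Measure (ℝ × ℝ)).restrict (cell T)
    = (volume.restrict (Ioc 0 (2 * π))).prod (timeMeasure T) := by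
  unfold cell timeMeasure
  rw [← Measure.restrict_congr_set (Ioo_ae_eq_Ioc (μ := volume) (a := 0) (b := 2 * π)),
    Measure.prod_restrict]
  rfl

/-! ### Lifting to the plane -/

section Lift

variable {y₀ : ℝ} {σ : ℤ} {T : ℝ}

/-- The chart `(ξ, t) ↦ (x, t)`. -/
noncomputable def chartMap (y₀ : ℝ) (σ : ℤ) (p : ℝ × ℝ) : Torus × ℝ := (chartPoint y₀ σ p.1, p.2)

lemma measurePreserving_chartMap (hσ : σ = 1 ∨ σ = -1) :
    MeasurePreserving (chartMap y₀ σ) (volume.restrict (cell T)) (spaceTimeMeasure T) := by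
  rw [volume_restrict_cell]
  have : SFinite (timeMeasure T) := inferInstance
  exact (measurePreserving_chartPoint (y₀ := y₀) hσ).prod (MeasurePreserving.id (timeMeasure T))

lemma measurePreserving_chartMap_symm (hσ : σ = 1 ∨ σ = -1) :
    MeasurePreserving (fun z : Torus × ℝ => (chartCoord y₀ σ z.1, z.2)) (spaceTimeMeasure T)
      (volume.restrict (cell T)) := by
  rw [volume_restrict_cell]
  exact (measurePreserving_chartCoord (y₀ := y₀) hσ).prod (MeasurePreserving.id (timeMeasure T))

/-- The lift of a function on `𝕋 × (0, T)` to the plane, extended by zero outside the cell. -/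
noncomputable def planeLift (y₀ : ℝ) (σ : ℤ) (T : ℝ) (G : Torus × ℝ → ℝ) : ℝ × ℝ → ℝ :=
  (cell T).indicator fun p => G (chartMap y₀ σ p)

lemma planeLift_of_mem {G : Torus × ℝ → ℝ} {p : ℝ × ℝ} (hp : p ∈ cell T) :
    planeLift y₀ σ T G p = G (chartMap y₀ σ p) := indicator_of_mem hp _

lemma planeLift_of_notMem {G : Torus × ℝ → ℝ} {p : ℝ × ℝ} (hp : p ∉ cell T) :
    planeLift y₀ σ T G p = 0 := indicator_of_notMem hp _

lemma planeLift_eq_zero {G : Torus × ℝ → ℝ} {p : ℝ × ℝ} (hp : p.1 ≤ 0) :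
    planeLift y₀ σ T G p = 0 := planeLift_of_notMem fun h => by linarith [h.1.1]

lemma integrable_planeLift (hσ : σ = 1 ∨ σ = -1) {G : Torus × ℝ → ℝ}
    (hG : Integrable G (spaceTimeMeasure T)) : Integrable (planeLift y₀ σ T G) :=
  (integrable_indicator_iff (isOpen_cell T).measurableSet).2
    ((measurePreserving_chartMap hσ).integrable_comp_of_integrable hG)

lemma integral_planeLift (hσ : σ = 1 ∨ σ = -1) {G : Torus × ℝ → ℝ}
    (hG : AEStronglyMeasurable G (spaceTimeMeasure T)) :
    ∫ p, planeLift y₀ σ T G p = ∫ z, G z ∂(spaceTimeMeasure T) := by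
  have mp := measurePreserving_chartMap (y₀ := y₀) (T := T) hσ
  unfold planeLift
  rw [integral_indicator (isOpen_cell T).measurableSet]
  rw [← mp.map_eq] at hG ⊢
  rw [integral_map mp.measurable.aemeasurable hG]

lemma ae_chartMap (hσ : σ = 1 ∨ σ = -1) {Q : Torus × ℝ → Prop}
    (h : ∀ᵐ z ∂(spaceTimeMeasure T), Q z) : ∀ᵐ p, p ∈ cell T → Q (chartMap y₀ σ p) := by
  rw [← ae_restrict_iff' (isOpen_cell T).measurableSet]
  exact (measurePreserving_chartMap hσ).quasiMeasurePreserving.ae h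

lemma ae_of_ae_chartMap (hσ : σ = 1 ∨ σ = -1) {Q : ℝ × ℝ → Prop}
    (h : ∀ᵐ p, p ∈ cell T → Q p) :
    ∀ᵐ z ∂(spaceTimeMeasure T), (chartCoord y₀ σ z.1, z.2) ∈ cell T
      ∧ Q (chartCoord y₀ σ z.1, z.2) := by
  have h' : ∀ᵐ p ∂(volume.restrict (cell T)), p ∈ cell T ∧ Q p := by
    rw [ae_restrict_iff' (isOpen_cell T).measurableSet]
    filter_upwards [h] with p hp hpc
    exact ⟨hpc, hp hpc⟩
  exact (measurePreserving_chartMap_symm (y₀ := y₀) hσ).quasiMeasurePreserving.ae h'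

/-- Both ends `ξ = 0` and `ξ = 2π` of the chart represent `y₀ ∈ O`, and `O` is open. -/
lemma exists_chart_margin {O : Set Torus} (hO : IsOpen O) (hy : (y₀ : Torus) ∈ O) :
    ∃ ε, 0 < ε ∧ ε < π ∧
      ∀ ξ ∈ Ioo 0 (2 * π), ξ ∉ Ioo ε (2 * π - ε) → chartPoint y₀ σ ξ ∈ O := by
  have hpre : IsOpen (chartPoint y₀ σ ⁻¹' O) := hO.preimage continuous_chartPoint
  have h0 : (0 : ℝ) ∈ chartPoint y₀ σ ⁻¹' O := by simpa [chartPoint] using hy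
  have h1 : 2 * π ∈ chartPoint y₀ σ ⁻¹' O := by
    have : chartPoint y₀ σ (2 * π) = (y₀ : Torus) := by
      unfold chartPoint
      rw [AddCircle.coe_add, ← zsmul_eq_mul, AddCircle.coe_zsmul, AddCircle.coe_period, smul_zero,
        add_zero]
    simpa [this] using hy
  obtain ⟨a, ha, hA⟩ := Metric.isOpen_iff.1 hpre _ h0
  obtain ⟨b, hb, hB⟩ := Metric.isOpen_iff.1 hpre _ h1
  have hpi := Real.pi_pos
  have hm : 0 < min (min a b) π := lt_min (lt_min ha hb) hpi
  have e1 := min_le_left (min a b) π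
  have e2 := min_le_right (min a b) π
  have e3 := min_le_left a b
  have e4 := min_le_right a b
  refine ⟨min (min a b) π / 2, by linarith, by linarith, fun ξ hξ hn => ?_⟩
  rw [mem_Ioo, not_and_or, not_lt, not_lt] at hn
  rcases hn with hn | hn
  · apply hA
    rw [Metric.mem_ball, Real.dist_eq, abs_lt]
    constructor <;> linarith [hξ.1]
  · apply hB
    rw [Metric.mem_ball, Real.dist_eq, abs_lt]
    constructor <;> linarith [hξ.2]

/-- An admissible `φ` does not descend to the torus, but it agrees with a genuine test function off
a margin on which `u` and `w` vanish. The factor `(-1) ^ j` comes from integration by parts and `σ ^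
j` from the chain rule. -/
lemma planeLift_weakDeriv (hσ : σ = 1 ∨ σ = -1) {O : Set Torus} (hO : IsOpen O)
    (hy : (y₀ : Torus) ∈ O) {j : ℕ} {u w : Torus → ℝ → ℝ} (h : IsWeakSpaceDeriv T j u w)
    (hu : Integrable (Function.uncurry u) (spaceTimeMeasure T))
    (hw : Integrable (Function.uncurry w) (spaceTimeMeasure T))
    (hvan : ∀ᵐ z ∂(spaceTimeMeasure T), z.1 ∈ O → u z.1 z.2 = 0)
    {φ : ℝ × ℝ → ℝ} (hφ : Admissible T φ) :
    ∫ p, planeLift y₀ σ T (Function.uncurry u) p * (dirDeriv (1, 0))^[j] φ p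
      = (-σ : ℝ) ^ j * ∫ p, planeLift y₀ σ T (Function.uncurry w) p * φ p := by
  have hσ2 : (σ : ℝ) * σ = 1 := by rcases hσ with rfl | rfl <;> norm_num
  obtain ⟨ε, hε, hεπ, hmargin⟩ := exists_chart_margin (σ := σ) hO hy
  obtain ⟨Φ, hΦ, hsm, hdX, -⟩ := exists_testFunction (y₀ := y₀) hσ hφ hε hεπ
  have key : ∀ (i : ℕ) {v : Torus → ℝ → ℝ}, Integrable (Function.uncurry v) (spaceTimeMeasure T) →
      (∀ᵐ z ∂(spaceTimeMeasure T), z.1 ∈ O → v z.1 z.2 = 0) →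
      ∫ p, planeLift y₀ σ T (Function.uncurry v) p * (dirDeriv (1, 0))^[i] φ p
        = (σ : ℝ) ^ i * ∫ z, v z.1 z.2 * dX i Φ z.1 z.2 ∂(spaceTimeMeasure T) := by
    intro i v hv hv0
    have i1 : Integrable (fun z : Torus × ℝ => v z.1 z.2 * dX i Φ z.1 z.2) (spaceTimeMeasure T) :=
      hΦ.integrable_mul_dX i hv
    rw [← integral_planeLift (y₀ := y₀) hσ i1.aestronglyMeasurable, ← integral_const_mul]
    refine integral_congr_ae ?_
    filter_upwards [ae_chartMap (y₀ := y₀) hσ hv0] with p hp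
    by_cases hpc : p ∈ cell T
    · simp only [planeLift_of_mem hpc, Function.uncurry]
      by_cases hpξ : p.1 ∈ Ioo ε (2 * π - ε)
      · have h2 : dX i Φ (chartMap y₀ σ p).1 (chartMap y₀ σ p).2 = _ := hdX i p.1 hpξ p.2
        rw [h2, mul_left_comm, ← mul_assoc ((σ : ℝ) ^ i), ← mul_pow, hσ2, one_pow, one_mul]
      · rw [hp hpc (hmargin _ hpc.1 hpξ)]
        simp
    · simp [planeLift_of_notMem hpc]
  have k0 := key 0 hw (h.ae_eq_zero_on hO hvan)
  simp only [Function.iterate_zero, id, pow_zero, one_mul] at k0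
  rw [key j hu hvan, k0, integral_mul_dX hΦ hsm h hu hw, neg_pow (σ : ℝ)]
  ring

/-- Admissible functions may be unbounded on the plane, but over the cell their support lies in a
compact rectangle. -/
lemma Admissible.exists_bound {φ : ℝ × ℝ → ℝ} (hφ : Admissible T φ) :
    ∃ C, ∀ p ∈ cell T, ‖φ p‖ ≤ C := by
  obtain ⟨hs, t₀, t₁, -, -, h⟩ := hφ
  obtain ⟨C, hC⟩ := ((isCompact_Icc (a := (0 : ℝ)) (b := 2 * π)).prod
    (isCompact_Icc (a := t₀) (b := t₁))).exists_bound_of_continuousOn hs.continuous.continuousOn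
  refine ⟨max C 0, fun p hp => ?_⟩
  by_cases h0 : φ p = 0
  · rw [h0, norm_zero]; exact le_max_right _ _
  · exact (hC p ⟨Ioo_subset_Icc_self hp.1, h p hp.1 h0⟩).trans (le_max_left _ _)

lemma Admissible.integrable_planeLift_mul (hσ : σ = 1 ∨ σ = -1) {φ : ℝ × ℝ → ℝ}
    (hφ : Admissible T φ) {G : Torus × ℝ → ℝ} (hG : Integrable G (spaceTimeMeasure T)) :
    Integrable fun p => planeLift y₀ σ T G p * φ p := by
  obtain ⟨C, hC⟩ := hφ.exists_bound
  have hl := integrable_planeLift (y₀ := y₀) hσ hG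
  refine (hl.norm.mul_const C).mono'
    (hl.aestronglyMeasurable.mul hφ.1.continuous.aestronglyMeasurable)
    (Filter.Eventually.of_forall fun p => ?_)
  by_cases hp : p ∈ cell T
  · rw [norm_mul]
    exact mul_le_mul_of_nonneg_left (hC p hp) (norm_nonneg _)
  · simp [planeLift_of_notMem hp]

end Lift

lemma MemLinftyLinfty.exists_bound {T : ℝ} {g : Torus → ℝ → ℝ} (h : MemLinftyLinfty T g) :
    ∃ C, 0 ≤ C ∧ ∀ᵐ z ∂(spaceTimeMeasure T), |g z.1 z.2| ≤ C := by
  refine ⟨(eLpNorm (Function.uncurry g) ⊤ (spaceTimeMeasure T)).toReal, ENNReal.toReal_nonneg, ?_⟩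
  rw [eLpNorm_exponent_top]
  filter_upwards [ae_le_eLpNormEssSup (f := Function.uncurry g) (μ := spaceTimeMeasure T)] with z hz
  have hne : eLpNormEssSup (Function.uncurry g) (spaceTimeMeasure T) ≠ ⊤ := by
    have := h.2.ne
    rwa [eLpNorm_exponent_top] at this
  have := ENNReal.toReal_mono hne hz
  rwa [toReal_enorm, Real.norm_eq_abs] at this

lemma MemLinftyLinfty.integrable_mul {T : ℝ} {g v : Torus → ℝ → ℝ} (h : MemLinftyLinfty T g)
    (hv : Integrable (Function.uncurry v) (spaceTimeMeasure T)) :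
    Integrable (fun z : Torus × ℝ => g z.1 z.2 * v z.1 z.2) (spaceTimeMeasure T) := by
  obtain ⟨C, -, hC⟩ := h.exists_bound
  exact hv.bdd_mul h.1 (f := Function.uncurry g) hC

/-! ### The equation in a chart -/

section Equation

variable {y₀ : ℝ} {σ : ℤ} {T a b b₁ : ℝ}

lemma dirDeriv_iterate_dirDeriv {φ : ℝ × ℝ → ℝ} (hφ : ContDiff ℝ ∞ φ) (d e : ℝ × ℝ) (j : ℕ) :
    (dirDeriv d)^[j] (dirDeriv e φ) = dirDeriv e ((dirDeriv d)^[j] φ) := by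
  induction j with
  | zero => rfl
  | succ j ih =>
    rw [Function.iterate_succ_apply', ih, dirDeriv_comm (hφ.dirDeriv_iterate d j),
      Function.iterate_succ_apply']

/-- The weak equation in the chart. -/
lemma planeLift_equation (hσ : σ = 1 ∨ σ = -1) {O : Set Torus} (hO : IsOpen O)
    (hy : (y₀ : Torus) ∈ O) {q p r u u₁ u₂ u₃ : Torus → ℝ → ℝ}
    (hu : Integrable (Function.uncurry u) (spaceTimeMeasure T))
    (hS : Integrable (fun z : Torus × ℝ => q z.1 z.2 * u₁ z.1 z.2 + p z.1 z.2 * u₃ z.1 z.2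
      + r z.1 z.2 * u₂ z.1 z.2) (spaceTimeMeasure T))
    (hvan : ∀ᵐ z ∂(spaceTimeMeasure T), z.1 ∈ O → u z.1 z.2 = 0)
    (hvan₁ : ∀ᵐ z ∂(spaceTimeMeasure T), z.1 ∈ O → u₁ z.1 z.2 = 0)
    (hvan₂ : ∀ᵐ z ∂(spaceTimeMeasure T), z.1 ∈ O → u₂ z.1 z.2 = 0)
    (hvan₃ : ∀ᵐ z ∂(spaceTimeMeasure T), z.1 ∈ O → u₃ z.1 z.2 = 0)
    (heq : ∀ φ : Torus → ℝ → ℝ, IsTestFunction T φ →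
      ∫ z, (u z.1 z.2 * (-(dTX 0 φ z.1 z.2) + b₁ * dTX 2 φ z.1 z.2 - b * dTX 4 φ z.1 z.2
              - a * dX 5 φ z.1 z.2)
          + (q z.1 z.2 * u₁ z.1 z.2 + p z.1 z.2 * u₃ z.1 z.2 + r z.1 z.2 * u₂ z.1 z.2)
              * φ z.1 z.2) ∂(spaceTimeMeasure T) = 0)
    {φ : ℝ × ℝ → ℝ} (hφ : Admissible T φ) :
    ∫ x, (planeLift y₀ σ T (Function.uncurry u) x * (-(dirDeriv (0, 1) φ x)
        + b₁ * dirDeriv (0, 1) ((dirDeriv (1, 0))^[2] φ) x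
        - b * dirDeriv (0, 1) ((dirDeriv (1, 0))^[4] φ) x - σ * a * (dirDeriv (1, 0))^[5] φ x)
      + planeLift y₀ σ T (fun z : Torus × ℝ => q z.1 z.2 * u₁ z.1 z.2 + p z.1 z.2 * u₃ z.1 z.2
          + r z.1 z.2 * u₂ z.1 z.2) x * φ x) = 0 := by
  have hσ2 : (σ : ℝ) ^ 2 = 1 := by rcases hσ with rfl | rfl <;> norm_num
  obtain ⟨ε, hε, hεπ, hmargin⟩ := exists_chart_margin (σ := σ) hO hy
  obtain ⟨Φ, hΦ, -, hdX, hdTX⟩ := exists_testFunction (y₀ := y₀) hσ hφ hε hεπ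
  have h0 := heq Φ hΦ
  have m1 : Integrable (fun z : Torus × ℝ => u z.1 z.2 * dTX 0 Φ z.1 z.2) (spaceTimeMeasure T) :=
    hΦ.integrable_mul_dTX 0 hu
  have m2 : Integrable (fun z : Torus × ℝ => u z.1 z.2 * dTX 2 Φ z.1 z.2) (spaceTimeMeasure T) :=
    hΦ.integrable_mul_dTX 2 hu
  have m3 : Integrable (fun z : Torus × ℝ => u z.1 z.2 * dTX 4 Φ z.1 z.2) (spaceTimeMeasure T) :=
    hΦ.integrable_mul_dTX 4 hu
  have m4 : Integrable (fun z : Torus × ℝ => u z.1 z.2 * dX 5 Φ z.1 z.2) (spaceTimeMeasure T) :=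
    hΦ.integrable_mul_dX 5 hu
  have m5 := hΦ.integrable_mul_dX 0 hS
  have hint : Integrable (fun z : Torus × ℝ =>
      u z.1 z.2 * (-(dTX 0 Φ z.1 z.2) + b₁ * dTX 2 Φ z.1 z.2 - b * dTX 4 Φ z.1 z.2
              - a * dX 5 Φ z.1 z.2)
          + (q z.1 z.2 * u₁ z.1 z.2 + p z.1 z.2 * u₃ z.1 z.2 + r z.1 z.2 * u₂ z.1 z.2)
              * Φ z.1 z.2) (spaceTimeMeasure T) := by
    refine (((((m1.neg).add (m2.const_mul b₁)).sub (m3.const_mul b)).sub (m4.const_mul a)).add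
      m5).congr (Filter.Eventually.of_forall fun z => ?_)
    simp only [Pi.add_apply, Pi.sub_apply, Pi.neg_apply]
    have : dX 0 Φ z.1 z.2 = Φ z.1 z.2 := rfl
    rw [this]
    ring
  rw [← integral_planeLift (y₀ := y₀) hσ hint.aestronglyMeasurable] at h0
  refine Eq.trans (integral_congr_ae ?_) h0
  filter_upwards [ae_chartMap (y₀ := y₀) hσ hvan, ae_chartMap (y₀ := y₀) hσ hvan₁,
    ae_chartMap (y₀ := y₀) hσ hvan₂, ae_chartMap (y₀ := y₀) hσ hvan₃] with x e0 e1 e2 e3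
  by_cases hx : x ∈ cell T
  · simp only [planeLift_of_mem hx, Function.uncurry]
    by_cases hxξ : x.1 ∈ Ioo ε (2 * π - ε)
    · have t0 : dTX 0 Φ (chartMap y₀ σ x).1 (chartMap y₀ σ x).2 = _ := hdTX 0 x.1 hxξ x.2
      have t2 : dTX 2 Φ (chartMap y₀ σ x).1 (chartMap y₀ σ x).2 = _ := hdTX 2 x.1 hxξ x.2
      have t4 : dTX 4 Φ (chartMap y₀ σ x).1 (chartMap y₀ σ x).2 = _ := hdTX 4 x.1 hxξ x.2
      have d5 : dX 5 Φ (chartMap y₀ σ x).1 (chartMap y₀ σ x).2 = _ := hdX 5 x.1 hxξ x.2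
      have d0 : Φ (chartMap y₀ σ x).1 (chartMap y₀ σ x).2 = _ := hdX 0 x.1 hxξ x.2
      have s4 : (σ : ℝ) ^ 4 = 1 := by rw [show (σ : ℝ) ^ 4 = (σ ^ 2) ^ 2 by ring, hσ2, one_pow]
      have s5 : (σ : ℝ) ^ 5 = σ := by rw [pow_succ, s4, one_mul]
      rw [t0, t2, t4, d5, d0, hσ2, s4, s5]
      simp only [Function.iterate_zero, id, pow_zero, one_mul, Prod.mk.eta]
      ring
    · have hO' := hmargin _ hx.1 hxξ
      rw [e0 hx hO', e1 hx hO', e2 hx hO', e3 hx hO']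
      ring
  · simp [planeLift_of_notMem hx]

end Equation

/-- Vanishing on one of the two domains of dependence. -/
lemma ae_eq_zero_of_chart {σ : ℤ} (hσ : σ = 1 ∨ σ = -1) {y₀ T a b b₁ : ℝ} (ha : a ≠ 0) (hb : b ≠ 0)
    {q p r u u₁ u₂ u₃ : Torus → ℝ → ℝ}
    (hq : MemLinftyLinfty T q) (hp : MemLinftyLinfty T p) (hr : MemLinftyLinfty T r)
    {O : Set Torus} (hO : IsOpen O) (hy : (y₀ : Torus) ∈ O)
    (h₁ : IsWeakSpaceDeriv T 1 u u₁) (h₂ : IsWeakSpaceDeriv T 2 u u₂)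
    (h₃ : IsWeakSpaceDeriv T 3 u u₃)
    (i₀ : Integrable (Function.uncurry u) (spaceTimeMeasure T))
    (i₁ : Integrable (Function.uncurry u₁) (spaceTimeMeasure T))
    (i₂ : Integrable (Function.uncurry u₂) (spaceTimeMeasure T))
    (i₃ : Integrable (Function.uncurry u₃) (spaceTimeMeasure T))
    (heq : ∀ φ : Torus → ℝ → ℝ, IsTestFunction T φ →
      ∫ z, (u z.1 z.2 * (-(dTX 0 φ z.1 z.2) + b₁ * dTX 2 φ z.1 z.2 - b * dTX 4 φ z.1 z.2
              - a * dX 5 φ z.1 z.2)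
          + (q z.1 z.2 * u₁ z.1 z.2 + p z.1 z.2 * u₃ z.1 z.2 + r z.1 z.2 * u₂ z.1 z.2)
              * φ z.1 z.2) ∂(spaceTimeMeasure T) = 0)
    (hvan : ∀ᵐ z ∂(spaceTimeMeasure T), z.1 ∈ O → u z.1 z.2 = 0) :
    ∀ᵐ z ∂(spaceTimeMeasure T), (chartCoord y₀ σ z.1, z.2) ∈ cell T ∧
      (z.2 - σ * b / a * chartCoord y₀ σ z.1 ∈ Ioo 0 T → u z.1 z.2 = 0) := by
  have hσ1 : σ * σ = 1 := by rcases hσ with rfl | rfl <;> norm_num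
  have hσ2 : (σ : ℝ) ^ 2 = 1 := by rcases hσ with rfl | rfl <;> norm_num
  have hσa : |(σ : ℝ)| = 1 := by rcases hσ with rfl | rfl <;> simp
  have hvan₁ := h₁.ae_eq_zero_on hO hvan
  have hvan₂ := h₂.ae_eq_zero_on hO hvan
  have hvan₃ := h₃.ae_eq_zero_on hO hvan
  set k : ℝ := σ * b / a with hk
  let S : Torus × ℝ → ℝ := fun z => q z.1 z.2 * u₁ z.1 z.2 + p z.1 z.2 * u₃ z.1 z.2
      + r z.1 z.2 * u₂ z.1 z.2
  have hS : Integrable S (spaceTimeMeasure T) :=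
    ((hq.integrable_mul i₁).add (hp.integrable_mul i₃)).add (hr.integrable_mul i₂)
  let pl := planeLift y₀ σ T
  let w₀ := pl (Function.uncurry u)
  let w₁ := pl (Function.uncurry u₁)
  let w₂ := pl (Function.uncurry u₂)
  let w₃ := pl (Function.uncurry u₃)
  have j₀ : Integrable w₀ := integrable_planeLift hσ i₀
  have j₁ : Integrable w₁ := integrable_planeLift hσ i₁
  have j₂ : Integrable w₂ := integrable_planeLift hσ i₂
  have j₃ : Integrable w₃ := integrable_planeLift hσ i₃
  have jS : Integrable (pl S) := integrable_planeLift hσ hS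
  have d₁ : ∀ φ, Admissible T φ →
      ∫ x, w₀ x * dirDeriv (1, 0) φ x = -σ * ∫ x, w₁ x * φ x := fun φ hφ => by
    simpa using planeLift_weakDeriv hσ hO hy h₁ i₀ i₁ hvan hφ
  have d₂ : ∀ φ, Admissible T φ →
      ∫ x, w₀ x * dirDeriv (1, 0) (dirDeriv (1, 0) φ) x = ∫ x, w₂ x * φ x := fun φ hφ => by
    simpa [hσ2] using planeLift_weakDeriv hσ hO hy h₂ i₀ i₂ hvan hφ
  have d₃ : ∀ φ, Admissible T φ → ∫ x, w₀ x * dirDeriv (1, 0) (dirDeriv (1, 0)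
      (dirDeriv (1, 0) φ)) x = -σ * ∫ x, w₃ x * φ x := fun φ hφ => by
    have := planeLift_weakDeriv hσ hO hy h₃ i₀ i₃ hvan hφ
    rw [pow_succ, neg_sq, hσ2, one_mul] at this
    exact this
  obtain ⟨Q, hQ0, hQ⟩ := hq.exists_bound
  obtain ⟨P, hP0, hP⟩ := hp.exists_bound
  obtain ⟨R, hR0, hR⟩ := hr.exists_bound
  -- What is left of `k` times the equation after `k ∂ₜ` has been replaced by `D - ∂ₓ`.
  let F : ℝ × ℝ → ℝ := fun x => k * pl S x - σ * w₁ x + b₁ * (σ * w₃ x)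
  have jF : Integrable F :=
    ((jS.const_mul k).sub (j₁.const_mul σ)).add ((j₃.const_mul σ).const_mul b₁)
  have hSb : ∀ᵐ x, |pl S x| ≤ Q * |w₁ x| + P * |w₃ x| + R * |w₂ x| := by
    filter_upwards [ae_chartMap (y₀ := y₀) hσ hQ, ae_chartMap (y₀ := y₀) hσ hP,
      ae_chartMap (y₀ := y₀) hσ hR] with x eQ eP eR
    by_cases hx : x ∈ cell T
    · simp only [pl, w₁, w₂, w₃, planeLift_of_mem hx, Function.uncurry, S]
      refine (abs_add_three _ _ _).trans ?_
      simp only [abs_mul]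
      gcongr
      · exact eQ hx
      · exact eP hx
      · exact eR hx
    · simp [pl, w₁, w₂, w₃, planeLift_of_notMem hx]
  set C := |k| * (Q + P + R) + 1 + |b₁| with hCdef
  have hFb : ∀ᵐ x, |F x| ≤ C * (|σ * w₁ x| + |w₂ x| + |σ * w₃ x|) := by
    filter_upwards [hSb] with x hx
    simp only [F]
    have e1 : |σ * w₁ x| = |w₁ x| := by rw [abs_mul, hσa, one_mul]
    have e3 : |σ * w₃ x| = |w₃ x| := by rw [abs_mul, hσa, one_mul]
    have t1 : |k * pl S x - σ * w₁ x + b₁ * (σ * w₃ x)|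
        ≤ |k| * |pl S x| + |w₁ x| + |b₁| * |w₃ x| := by
      refine (abs_add_le _ _).trans ?_
      rw [abs_mul b₁, e3]
      gcongr
      refine (abs_sub _ _).trans ?_
      rw [abs_mul k, e1]
    have t2 : |k| * |pl S x| ≤ |k| * (Q * |w₁ x| + P * |w₃ x| + R * |w₂ x|) := by gcongr
    have t3 : Q * |w₁ x| + P * |w₃ x| + R * |w₂ x|
        ≤ (Q + P + R) * (|w₁ x| + |w₂ x| + |w₃ x|) := by
      have := abs_nonneg (w₁ x)
      have := abs_nonneg (w₂ x)
      have := abs_nonneg (w₃ x)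
      have : 0 ≤ Q * |w₂ x| := by positivity
      have : 0 ≤ Q * |w₃ x| := by positivity
      have : 0 ≤ P * |w₁ x| := by positivity
      have : 0 ≤ P * |w₂ x| := by positivity
      have : 0 ≤ R * |w₁ x| := by positivity
      have : 0 ≤ R * |w₃ x| := by positivity
      linarith
    have t4 := mul_le_mul_of_nonneg_left t3 (abs_nonneg k)
    rw [e1, e3, hCdef]
    have : 0 ≤ |b₁| * |w₁ x| := by positivity
    have : 0 ≤ |b₁| * |w₂ x| := by positivity
    have := abs_nonneg (w₂ x)
    have := abs_nonneg (w₃ x)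
    linarith
  -- Since `x = y₀ + σ ξ`, the first three `ξ`-derivatives of `w₀` are `σ w₁`, `w₂` and `σ w₃`.
  have main := ae_eq_zero_on_domainOfDependence (k := k) (T := T) (b := b) (b₁ := b₁) (C := C)
    (v₀ := w₀) (v₁ := fun x => σ * w₁ x) (v₂ := w₂) (v₃ := fun x => σ * w₃ x) (F := F) hb
    (by positivity) j₀ (j₁.const_mul σ) j₂ (j₃.const_mul σ) jF
    (fun x hx => planeLift_eq_zero hx)
    (fun x hx => by simp only [w₁, pl, planeLift_eq_zero hx, mul_zero])
    (fun x hx => planeLift_eq_zero hx)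
    (fun x hx => by simp only [w₃, pl, planeLift_eq_zero hx, mul_zero])
    (fun x hx => by simp only [F, w₁, w₃, pl, planeLift_eq_zero hx]; ring)
    hFb ?_ ?_ ?_ ?_
  · filter_upwards [ae_of_ae_chartMap (y₀ := y₀) hσ (main.mono fun x hx (hc : x ∈ cell T) =>
      fun h : x.2 - k * x.1 ∈ Ioo 0 T => hx ⟨hc, h⟩)] with z hz
    refine ⟨hz.1, fun h => ?_⟩
    have h0 := hz.2 h
    simp only [w₀, pl, planeLift_of_mem hz.1, chartMap, chartPoint_chartCoord hσ1] at h0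
    exact h0
  · intro φ hφ
    simp only [mul_assoc, integral_const_mul]
    linarith [d₁ φ hφ]
  · intro φ hφ
    have e1 := d₁ _ (hφ.dirDeriv (1, 0))
    rw [d₂ φ hφ] at e1
    simp only [mul_assoc, integral_const_mul]
    linarith
  · intro φ hφ
    have e1 := d₂ _ (hφ.dirDeriv (1, 0))
    rw [d₃ φ hφ] at e1
    simp only [mul_assoc, integral_const_mul]
    linarith
  · intro φ hφ
    have hζ : Admissible T (dirDeriv (1, k) φ) := hφ.dirDeriv _
    set ζ := dirDeriv (1, k) φ with hζdef
    have heq' := planeLift_equation hσ hO hy i₀ hS hvan hvan₁ hvan₂ hvan₃ heq hφ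
    have I : ∀ {G : Torus × ℝ → ℝ} {ψ : ℝ × ℝ → ℝ}, Integrable G (spaceTimeMeasure T) →
        Admissible T ψ → Integrable fun x => pl G x * ψ x :=
      fun hG hψ => hψ.integrable_planeLift_mul hσ hG
    have hD := fun {ψ : ℝ × ℝ → ℝ} (h : Admissible T ψ) => h.dirDeriv (1, 0)
    -- This value of `k` makes the two top-order terms combine into `b ∂ₓ⁴ D`.
    have ka : k * (σ * a) = b := by
      rw [hk]; field_simp; exact hσ2
    have ex : ∀ j x, (dirDeriv (1, 0))^[j] ζ x = (dirDeriv (1, 0))^[j + 1] φ x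
        + k * dirDeriv (0, 1) ((dirDeriv (1, 0))^[j] φ) x := by
      intro j x
      rw [hζdef, dirDeriv_iterate_dirDeriv hφ.1, dirDeriv_eq_add, Function.iterate_succ_apply']
    -- `k` times the weak equation, with `k ∂ₜ ∂ₓʲ φ` rewritten as `∂ₓʲ ζ - ∂ₓʲ⁺¹ φ`. Afterwards all
    -- but one `x`-derivative of `ζ` are moved onto `w₀`, because derivatives of `u` are at hand
    -- only up to order three.
    have e0 : ∫ x, (-(w₀ x * ζ x) + b₁ * (w₀ x * (dirDeriv (1, 0))^[2] ζ x)
        - b * (w₀ x * (dirDeriv (1, 0))^[4] ζ x) + w₀ x * dirDeriv (1, 0) φ x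
        - b₁ * (w₀ x * (dirDeriv (1, 0))^[3] φ x) + k * (pl S x * φ x)) = 0 := by
      refine Eq.trans (integral_congr_ae (Filter.Eventually.of_forall fun x => ?_))
        ((integral_const_mul k _).trans ((congrArg (k * ·) heq').trans (mul_zero k)))
      have x0 := ex 0 x
      have x2 := ex 2 x
      have x4 := ex 4 x
      simp only [Function.iterate_zero, id, zero_add, Function.iterate_one] at x0
      simp only [x0, x2, x4, w₀, pl, S]
      linear_combination planeLift y₀ σ T (Function.uncurry u) x
        * (dirDeriv (1, 0))^[5] φ x * ka
    have A0 : Integrable fun x => w₀ x * ζ x := I i₀ hζ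
    have A2 : Integrable fun x => b₁ * (w₀ x * (dirDeriv (1, 0))^[2] ζ x) :=
      (I i₀ (hζ.dirDeriv_iterate (1, 0) 2)).const_mul b₁
    have A4 : Integrable fun x => b * (w₀ x * (dirDeriv (1, 0))^[4] ζ x) :=
      (I i₀ (hζ.dirDeriv_iterate (1, 0) 4)).const_mul b
    have B1 : Integrable fun x => w₀ x * dirDeriv (1, 0) φ x := I i₀ (hD hφ)
    have B3 : Integrable fun x => b₁ * (w₀ x * (dirDeriv (1, 0))^[3] φ x) :=
      (I i₀ (hφ.dirDeriv_iterate (1, 0) 3)).const_mul b₁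
    have BS : Integrable fun x => k * (pl S x * φ x) := (I hS hφ).const_mul k
    have s1 : Integrable fun x => -(w₀ x * ζ x) + b₁ * (w₀ x * (dirDeriv (1, 0))^[2] ζ x) :=
      A0.neg.add A2
    have s2 : Integrable fun x => -(w₀ x * ζ x) + b₁ * (w₀ x * (dirDeriv (1, 0))^[2] ζ x)
        - b * (w₀ x * (dirDeriv (1, 0))^[4] ζ x) := s1.sub A4
    have s3 : Integrable fun x => -(w₀ x * ζ x) + b₁ * (w₀ x * (dirDeriv (1, 0))^[2] ζ x)
        - b * (w₀ x * (dirDeriv (1, 0))^[4] ζ x) + w₀ x * dirDeriv (1, 0) φ x := s2.add B1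
    have s4 : Integrable fun x => -(w₀ x * ζ x) + b₁ * (w₀ x * (dirDeriv (1, 0))^[2] ζ x)
        - b * (w₀ x * (dirDeriv (1, 0))^[4] ζ x) + w₀ x * dirDeriv (1, 0) φ x
        - b₁ * (w₀ x * (dirDeriv (1, 0))^[3] φ x) := s3.sub B3
    rw [integral_add s4 BS, integral_sub s3 B3, integral_add s2 B1, integral_sub s1 A4,
      integral_add A0.fun_neg A2, integral_neg] at e0
    simp only [integral_const_mul] at e0
    have q1 := d₁ φ hφ
    have q2 := d₁ _ (hD hζ)
    have q3 := d₃ φ hφ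
    have q4 := d₃ _ (hD hζ)
    have q2' : ∫ x, w₀ x * (dirDeriv (1, 0))^[2] ζ x = _ := q2
    have q4' : ∫ x, w₀ x * (dirDeriv (1, 0))^[4] ζ x = _ := q4
    have q3' : ∫ x, w₀ x * (dirDeriv (1, 0))^[3] φ x = _ := q3
    rw [q1, q2', q3', q4'] at e0
    have X3 : Integrable fun x => b * σ * (w₃ x * dirDeriv (1, 0) ζ x) :=
      (I i₃ (hD hζ)).const_mul _
    have X1 : Integrable fun x => b₁ * σ * (w₁ x * dirDeriv (1, 0) ζ x) :=
      (I i₁ (hD hζ)).const_mul _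
    have Y3 : Integrable fun x => b₁ * σ * (w₃ x * φ x) := (I i₃ hφ).const_mul _
    have Y1 : Integrable fun x => σ * (w₁ x * φ x) := (I i₁ hφ).const_mul _
    have X31 : Integrable fun x => b * σ * (w₃ x * dirDeriv (1, 0) ζ x)
        - b₁ * σ * (w₁ x * dirDeriv (1, 0) ζ x) := X3.sub X1
    have YS1 : Integrable fun x => k * (pl S x * φ x) - σ * (w₁ x * φ x) := BS.sub Y1
    have l1 : ∫ x, ((b * (σ * w₃ x) - b₁ * (σ * w₁ x)) * dirDeriv (1, 0) ζ x - w₀ x * ζ x)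
        = b * σ * (∫ x, w₃ x * dirDeriv (1, 0) ζ x) - b₁ * σ * (∫ x, w₁ x * dirDeriv (1, 0) ζ x)
          - ∫ x, w₀ x * ζ x := by
      rw [← integral_const_mul, ← integral_const_mul, ← integral_sub X3 X1, ← integral_sub X31 A0]
      exact integral_congr_ae (Filter.Eventually.of_forall fun x => by ring)
    have l2 : ∫ x, F x * φ x
        = k * (∫ x, pl S x * φ x) - σ * (∫ x, w₁ x * φ x) + b₁ * σ * ∫ x, w₃ x * φ x := by
      rw [← integral_const_mul, ← integral_const_mul, ← integral_const_mul, ← integral_sub BS Y1,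
        ← integral_add YS1 Y3]
      exact integral_congr_ae (Filter.Eventually.of_forall fun x => by simp only [F]; ring)
    rw [l1, l2]
    linarith

/-! ### Covering by the two orientations -/

lemma chartCoord_neg_one {y₀ : ℝ} {x : Torus} (h : chartCoord y₀ 1 x ∈ Ioo 0 (2 * π)) :
    chartCoord y₀ (-1) x = 2 * π - chartCoord y₀ 1 x := by
  have h1 : chartPoint y₀ (-1) (2 * π - chartCoord y₀ 1 x) = x := by
    conv_rhs => rw [← chartPoint_chartCoord (y₀ := y₀) (σ := 1) (by norm_num) x]
    unfold chartPoint
    rw [show y₀ + ((-1 : ℤ) : ℝ) * (2 * π - chartCoord y₀ 1 x)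
      = (y₀ + ((1 : ℤ) : ℝ) * chartCoord y₀ 1 x) - 2 * π by push_cast; ring]
    rw [AddCircle.coe_sub, AddCircle.coe_period, sub_zero]
  conv_lhs => rw [← h1]
  exact chartCoord_chartPoint (by norm_num) ⟨by linarith [h.2], by linarith [h.1]⟩

theorem theorem2p1 (a b b₁ T : ℝ) (ha : a ≠ 0) (hb : b ≠ 0) (hT : 2 * π * |b| / |a| < T)
    (q p r : Torus → ℝ → ℝ)
    (hq : MemLinftyLinfty T q) (hp : MemLinftyLinfty T p) (hr : MemLinftyLinfty T r)
    (O : Set Torus) (hO : IsOpen O) (hO' : O.Nonempty)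
    (u : Torus → ℝ → ℝ) (hu : MemLpSobolev 2 4 T u ∨ MemLpSobolev ∞ 3 T u)
    (hsol : IsWeakSolution a b b₁ T q p r u)
    (hvan : ∀ᵐ z ∂(spaceTimeMeasure T), z.1 ∈ O → u z.1 z.2 = 0) :
    ∀ᵐ z ∂(spaceTimeMeasure T), u z.1 z.2 = 0 := by
  obtain ⟨u₁, u₂, u₃, h₁, h₂, h₃, heq⟩ := hsol
  obtain ⟨x₀, hx₀⟩ := hO'
  obtain ⟨y₀, rfl⟩ := QuotientAddGroup.mk_surjective x₀
  have hint : ∀ {j : ℕ} {w : Torus → ℝ → ℝ}, j ≤ 3 → IsWeakSpaceDeriv T j u w →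
      Integrable (Function.uncurry w) (spaceTimeMeasure T) := fun hj hw =>
    hu.elim (fun h => h.integrable one_le_two (hj.trans (by norm_num)) hw)
      (fun h => h.integrable le_top hj hw)
  have h₀ : IsWeakSpaceDeriv T 0 u u := by
    refine ⟨h₁.1, h₁.1, ?_⟩
    filter_upwards [h₁.2.2] with t ht
    exact ⟨ht.1, ht.1, fun φ _ => by simp⟩
  have key := fun (σ : ℤ) (hσ : σ = 1 ∨ σ = -1) => ae_eq_zero_of_chart hσ (y₀ := y₀) ha hb hq hp hr
    hO hx₀ h₁ h₂ h₃ (hint (by norm_num) h₀) (hint (by norm_num) h₁) (hint (by norm_num) h₂)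
    (hint (by norm_num) h₃) heq hvan
  filter_upwards [key 1 (Or.inl rfl), key (-1) (Or.inr rfl)] with z hz hz'
  obtain ⟨hc, hz⟩ := hz
  obtain ⟨-, hz'⟩ := hz'
  rw [chartCoord_neg_one hc.1] at hz'
  have hk : |b / a| * (2 * π) < T := by rw [abs_div]; convert hT using 1; ring
  push_cast at hz hz'
  rw [one_mul] at hz
  rw [neg_one_mul, neg_div] at hz'
  set k := b / a
  set ξ := chartCoord y₀ 1 z.1
  obtain ⟨⟨c1, c2⟩, c3, c4⟩ := hc
  -- For `k ≥ 0` the foot `t - k ξ` can leave `(0, T)` only by being `≤ 0`. The foot for the other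
  -- orientation is larger by `2π k < T`, and it is positive because `t > 0`, so it lies in `(0,
  -- T)`. For `k ≤ 0` the roles of the two ends are exchanged.
  by_cases h : z.2 - k * ξ ∈ Ioo 0 T
  · exact hz h
  · refine hz' ?_
    rw [mem_Ioo, not_and_or, not_lt, not_lt] at h
    simp only at c1 c2 c3 c4
    have e : -k * (2 * π - ξ) = -(k * (2 * π)) + k * ξ := by ring
    have c5 : 0 < 2 * π - ξ := by linarith
    rcases le_total 0 k with hk0 | hk0
    · rw [abs_of_nonneg hk0] at hk
      have a1 := mul_nonneg hk0 c1.le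
      have a2 := mul_nonneg hk0 c5.le
      rcases h with h | h
      · constructor <;> linarith
      · linarith
    · rw [abs_of_nonpos hk0] at hk
      have a1 := mul_nonpos_of_nonpos_of_nonneg hk0 c1.le
      have a2 := mul_nonpos_of_nonpos_of_nonneg hk0 c5.le
      rcases h with h | h
      · linarith
      · constructor <;> linarith
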